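/- **Setting.** Let $k\ge 0$, let $\gamma_k$ be the canonical Gaussian measure on $\mathbb R^k$ with density $\varphi(x)=(2\pi)^{-k/2}e^{-\|x\|^2/2}$, and let $F\in C^2(\mathbb R^k)$ be real-valued. A $C^2$ domain is a closed set $D\subseteq\mathbb R^k$ with nonempty interior whose boundary is an embedded $C^2$ hypersurface with $D$ on one side of it; $\nu$ is its outward unit normal field, $S_pX=-\nabla_X\nu$ its shape operator on $T_p\partial D$, and $\mathcal H_{k-1}$ is Hausdorff measure. Let $\mathcal M_j^{\lambda}(D,dp)$, $j\ge1$, be the coefficient of $r^{j-1}/(j-1)!$ in Steiner's formula, i.e. in $\det(I-rS_p)\,d\mathcal H_{k-1}(p)$ on $\partial D$. Put $\mathcal M_0^{\gamma_k}(D)=\gamma_k(D)$ and, for $l\ge1$, $$\mathcal M_l^{\gamma_k}(D)=\int_{\partial D}\sum_{m=0}^{l-1}\binom{l-1}{m}\frac{d^{\,l-1-m}\varphi}{d\nu^{\,l-1-m}}\,\mathcal M_{m+1}^{\lambda}(D,dp),$$ called finite if the integral converges absolutely ($\mathcal M_0^{\gamma_k}$ is always finite). Let $$G_1=\|\nabla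 F\|,\qquad G_2=-LF+\frac{\nabla^2F(\nabla F,\nabla F)}{\|\nabla F\|^2},\qquad LF(x)=\sum_{i=1}^k\frac{\partial^2F}{\partial x_i^2}(x)-\sum_{i=1}^k x_i\frac{\partial F}{\partial x_i}(x)$$ (a quotient by $0$ is read as $0$). All expectations are with respect to $\gamma_k$; $E[\,\cdot\mid F=u]$ is taken with respect to a regular conditional distribution, and $\varphi_F$ is the density of the law of $F$ (of its absolutely continuous part, if the law is not absolutely continuous). Write $D_u=F^{-1}[u,\infty)$. **Corollary 3.5.** (a) For Lebesgue-almost every $u\in\mathbb R$: if $D_u$ is a $C^2$ domain and $\mathcal M_1^{\gamma_k}(D_u)$ and $\mathcal M_2^{\gamma_k}(D_u)$ are finite, then $$\mathcal M_1^{\gamma_k}(D_u)=E\big[\|\nabla F\|\,\big|\,F=u\big]\,\varphi_F(u),$$ $$\mathcal M_2^{\gamma_k}(D_u)=E\Big[-LF+\frac{\nabla^2F(\nabla F,\nabla F)}{\|\nabla F\|^2}\,\Big|\,F=u\Big]\,\varphi_F(u),$$ where both conditional expectations converge absolutely if $\varphi_F(u)\neq0$. Moreover, for such $u$ the functionals do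 not depend on the dimension: for all $n$, all injections $s:\{1,\dots,k\}\to\{1,\dots,n\}$ and $l=0,1,2$, the cylinder $\{y\in\mathbb R^n:(y_{s(1)},\dots,y_{s(k)})\in D_u\}$ has finite $\mathcal M_l^{\gamma_n}$, equal to $\mathcal M_l^{\gamma_k}(D_u)$. (b) For every individual level $u$ such that, for all $z$ in a neighbourhood of $u$, $D_z$ is a $C^2$ domain with $\mathcal M_1^{\gamma_k}(D_z)$ and $\mathcal M_2^{\gamma_k}(D_z)$ finite, the same formulas hold at $u$ in the sense $$\mathcal M_i^{\gamma_k}(D_u)=\lim_{\varepsilon\downarrow0}\frac1{2\varepsilon}E\big[G_i\,\mathbf 1_{\{|F-u|<\varepsilon\}}\big]$$ (the expectations existing for small $\varepsilon$), for $i=1$ if $z\mapsto\mathcal M_1^{\gamma_k}(D_z)$ is continuous at $u$, and for $i=2$ if $z\mapsto\mathcal M_2^{\gamma_k}(D_z)$ is continuous at $u$ and $G_2\mathbf 1_{\{|F-u|<\delta\}}$ is $\gamma_k$-integrable for some $\delta>0$. -/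

import Mathlib

open MeasureTheory ProbabilityTheory Filter Topology
open scoped ENNReal

noncomputable section

namespace GaussTube

/-- `g` is a local defining function of `D` at `p`: it is of class `C²` near `p`, its gradient at `p`
does not vanish, and near `p` the set `D` is the sublevel set `{g ≤ 0}`. -/
def IsLocalDefining {k : ℕ} (D : Set (EuclideanSpace ℝ (Fin k))) (p : EuclideanSpace ℝ (Fin k))
    (g : EuclideanSpace ℝ (Fin k) → ℝ) : Prop :=
  ContDiffAt ℝ 2 g p ∧ gradient g p ≠ 0 ∧ ∀ᶠ x in 𝓝 p, (x ∈ D ↔ g x ≤ 0)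

/-- A `C²` domain: a closed set with nonempty interior whose boundary is an embedded `C²`
hypersurface with the set on one side of it (so that it has an outward unit normal). -/
def IsC2Domain {k : ℕ} (D : Set (EuclideanSpace ℝ (Fin k))) : Prop :=
  IsClosed D ∧ (interior D).Nonempty ∧ ∀ p ∈ frontier D, ∃ g, IsLocalDefining D p g

open Classical in
/-- The outward unit normal of `D` at `p`, i.e. `∇g / ‖∇g‖` for a local defining function `g`
of `D` at `p` (at a boundary point this does not depend on `g`). -/
def outwardNormal {k : ℕ} (D : Set (EuclideanSpace ℝ (Fin k))) (p : EuclideanSpace ℝ (Fin k)) :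
    EuclideanSpace ℝ (Fin k) :=
  if h : ∃ g, IsLocalDefining D p g then
    ‖gradient h.choose p‖⁻¹ • gradient h.choose p
  else 0

/-- The shape operator `S_p X = -∇_X ν` of the hypersurface `∂D` on the tangent space `T_p ∂D = ν_pᗮ`,
extended by zero to the normal line. The field `ν` is differentiated along `∂D`; the orthogonal
projections onto `T_p ∂D` make the result independent of the choice made by `fderivWithin` in the
normal direction. -/
def shapeOperator {k : ℕ} (D : Set (EuclideanSpace ℝ (Fin k))) (p : EuclideanSpace ℝ (Fin k)) :
    EuclideanSpace ℝ (Fin k) →L[ℝ] EuclideanSpace ℝ (Fin k) :=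
  -((ℝ ∙ outwardNormal D p)ᗮ.starProjection ∘L
    fderivWithin ℝ (outwardNormal D) (frontier D) p ∘L
    (ℝ ∙ outwardNormal D p)ᗮ.starProjection)

/-- The density with respect to `(k-1)`-dimensional Hausdorff measure on `∂D` of the Minkowski
curvature measure `M_j^λ(D, ·)`, `j ≥ 1`. The map `p ↦ p + r ν_p` on `∂D` has Jacobian `det (1 - r S_p)`,
and `M_j^λ(D, ·)` is the coefficient of `r^(j-1)/(j-1)!` in Steiner's formula
`H_{k-1} {p + r ν_p | p ∈ A} = ∑_j r^(j-1)/(j-1)! M_j^λ(D, A)`. In particular the density vanishes for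
`j > k`, is `1` for `j = 1`, and is `-tr S_p` for `j = 2`. -/
def minkowskiDensity {k : ℕ} (D : Set (EuclideanSpace ℝ (Fin k))) (j : ℕ)
    (p : EuclideanSpace ℝ (Fin k)) : ℝ :=
  iteratedDeriv (j - 1) (fun r : ℝ =>
    (1 - r • shapeOperator D p : EuclideanSpace ℝ (Fin k) →L[ℝ] EuclideanSpace ℝ (Fin k)).det) 0

/-- The integrand (with respect to `H_{k-1}` on `∂D`) of the coefficient `C_l(D; φ)` of `r^l/l!` in the
expansion of `∫_{T(D,r)} φ`, for `l ≥ 1`: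
`∑_{m=0}^{l-1} (l-1 choose m) (d/dν)^{l-1-m} φ · dM_{m+1}^λ(D, ·)/dH_{k-1}`. -/
def tubeCoeffIntegrand {k : ℕ} (D : Set (EuclideanSpace ℝ (Fin k)))
    (φ : EuclideanSpace ℝ (Fin k) → ℝ) (l : ℕ) (p : EuclideanSpace ℝ (Fin k)) : ℝ :=
  ∑ m ∈ Finset.range l, ((l - 1).choose m : ℝ) *
    iteratedDeriv (l - 1 - m) (fun t : ℝ => φ (p + t • outwardNormal D p)) 0 *
    minkowskiDensity D (m + 1) p

/-- The coefficient `C_l(D; φ)`, `l ≥ 1`. The measure `μHE[k - 1]` is Hausdorff measure, normalized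
so that it agrees with Lebesgue measure on `ℝ^(k-1)`. (For `k = 0` the boundary is empty.) -/
def tubeCoeff {k : ℕ} (D : Set (EuclideanSpace ℝ (Fin k)))
    (φ : EuclideanSpace ℝ (Fin k) → ℝ) (l : ℕ) : ℝ :=
  ∫ p in frontier D, tubeCoeffIntegrand D φ l p ∂μHE[k - 1]

/-- The standard Gaussian density on `ℝ^k`. -/
def gaussDensity (k : ℕ) (x : EuclideanSpace ℝ (Fin k)) : ℝ :=
  (2 * Real.pi) ^ (-(k : ℝ) / 2) * Real.exp (-‖x‖ ^ 2 / 2)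

/-- The canonical Gaussian measure on `ℝ^k`, the law of `(Z_1, …, Z_k)` with `Z_i` i.i.d. `N(0,1)`. -/
abbrev gauss (k : ℕ) : Measure (EuclideanSpace ℝ (Fin k)) :=
  stdGaussian (EuclideanSpace ℝ (Fin k))

/-- The Gaussian Minkowski functional `M_l^γ(D)`. -/
def gaussMinkowski {k : ℕ} (D : Set (EuclideanSpace ℝ (Fin k))) : ℕ → ℝ
  | 0 => (gauss k).real D
  | l + 1 => tubeCoeff D (gaussDensity k) (l + 1)

/-- The Gaussian Minkowski functional `M_l^γ(D)` is finite: the integral over `∂D` which defines it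
converges absolutely. -/
def GaussMinkowskiFinite {k : ℕ} (D : Set (EuclideanSpace ℝ (Fin k))) : ℕ → Prop
  | 0 => True
  | l + 1 => IntegrableOn (tubeCoeffIntegrand D (gaussDensity k) (l + 1)) (frontier D) μHE[k - 1]

/-- The Hessian form `∇²F(x)(v, v)`. -/
def hess {k : ℕ} (F : EuclideanSpace ℝ (Fin k) → ℝ) (x v : EuclideanSpace ℝ (Fin k)) : ℝ :=
  iteratedFDeriv ℝ 2 F x ![v, v]

/-- The Ornstein–Uhlenbeck operator `LF(x) = ∑ᵢ ∂²F/∂xᵢ² - ∑ᵢ xᵢ ∂F/∂xᵢ`. -/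
def ornsteinUhlenbeck {k : ℕ} (F : EuclideanSpace ℝ (Fin k) → ℝ)
    (x : EuclideanSpace ℝ (Fin k)) : ℝ :=
  ∑ i, hess F x (EuclideanSpace.single i 1) -
    ∑ i, fderiv ℝ F x (EuclideanSpace.single i 1) * x i

/-- The function `‖∇F‖`. -/
def surfaceIntegrand {k : ℕ} (F : EuclideanSpace ℝ (Fin k) → ℝ)
    (x : EuclideanSpace ℝ (Fin k)) : ℝ :=
  ‖gradient F x‖

/-- The function `-LF + ∇²F(∇F, ∇F) / ‖∇F‖²` (the quotient is `0` where `∇F = 0`). -/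
def curvatureIntegrand {k : ℕ} (F : EuclideanSpace ℝ (Fin k) → ℝ)
    (x : EuclideanSpace ℝ (Fin k)) : ℝ :=
  -ornsteinUhlenbeck F x + hess F x (gradient F x) / ‖gradient F x‖ ^ 2

/-- The conditional law of a standard Gaussian vector given `F = u` (a regular conditional
distribution, determined for almost every `u` with respect to the law of `F`). -/
def condLaw {k : ℕ} (F : EuclideanSpace ℝ (Fin k) → ℝ) (u : ℝ) :
    Measure (EuclideanSpace ℝ (Fin k)) :=
  condDistrib (id : EuclideanSpace ℝ (Fin k) → EuclideanSpace ℝ (Fin k)) F (gauss k) u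

/-- The conditional expectation `E[G | F = u]`. -/
def condMean {k : ℕ} (G F : EuclideanSpace ℝ (Fin k) → ℝ) (u : ℝ) : ℝ :=
  ∫ x, G x ∂(condLaw F u)

/-- The density `φ_F` of `F(Z_1, …, Z_k)`, `Z_i` i.i.d. `N(0,1)`: the Radon–Nikodym derivative with
respect to Lebesgue measure of the law of `F` (of its absolutely continuous part, in general). -/
def lawDensity {k : ℕ} (F : EuclideanSpace ℝ (Fin k) → ℝ) (u : ℝ) : ℝ :=
  (pdf F (gauss k) volume u).toReal

/-- `E[G | F = u] φ_F(u) = c` at the individual level `u`, in the sense that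
`E[G 1_{|F - u| < ε}] / (2 ε) → c` as `ε → 0+`; the expectations are required to exist. -/
def HasCondDensityAt {k : ℕ} (G F : EuclideanSpace ℝ (Fin k) → ℝ) (u c : ℝ) : Prop :=
  (∀ᶠ ε in 𝓝[>] (0 : ℝ), IntegrableOn G {x | |F x - u| < ε} (gauss k)) ∧
    Tendsto (fun ε : ℝ => (2 * ε)⁻¹ * ∫ x in {x | |F x - u| < ε}, G x ∂(gauss k))
      (𝓝[>] 0) (𝓝 c)

/-- The set `F⁻¹[u, ∞)`. -/
def excursionSet {k : ℕ} (F : EuclideanSpace ℝ (Fin k) → ℝ) (u : ℝ) :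
    Set (EuclideanSpace ℝ (Fin k)) :=
  F ⁻¹' Set.Ici u

/-- The cylinder in `ℝ^n` over `D ⊆ ℝ^k`, the coordinates of `ℝ^k` being the coordinates
`s 0, …, s (k-1)` of `ℝ^n`. -/
def cylinder {k n : ℕ} (s : Fin k → Fin n) (D : Set (EuclideanSpace ℝ (Fin k))) :
    Set (EuclideanSpace ℝ (Fin n)) :=
  {y | WithLp.toLp 2 (fun i => y (s i)) ∈ D}

end GaussTube

end

/-! On the regular part of `{F = u}` the outward normal of `D_u` is `-∇F/‖∇F‖`. Write `φ` for the
Gaussian density. Differentiating this normal and `φ` along the boundary shows that the integrands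
of `M_1` and `M_2` are `φ G₁/‖∇F‖` and `φ G₂/‖∇F‖` (`tubeCoeffIntegrand_one`,
`tubeCoeffIntegrand_two`): the mean curvature gives the second-order part of `G₂`, the normal
derivative of `φ` its drift.

The coarea formula (`lintegral_levelMeasure`) cancels the factor `1/‖∇F‖`. Hence `u ↦ ∫_{F=u} φ
G⁺/‖∇F‖` is the Lebesgue density of the measure `B ↦ E[G⁺; F ∈ B]`, and likewise for `G⁻`.
Conditioning on `F` represents the same measure as `E[G⁺ | F = u]` times the law of `F`; comparing
the two gives (a). Averaging the density over `(u - ε, u + ε)` gives (b) at continuity points. Since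
`B ↦ E[G⁺; F ∈ B]` depends only on the joint law of `F` and `G`, it does not change on passing to a
cylinder, whence independence of the dimension.

Critical points must be negligible in two ways: for surface measure on almost every level
(`ae_level_critical`), so that `∂D_u` may be replaced by the regular part of the level set, and
under the Gaussian measure because `G₂ = 0` at almost every critical point
(`ae_curvatureIntegrand_eq_zero`). -/

namespace GaussTube

open Module Measure Set
open scoped RealInnerProductSpace NNReal

/-! ### The coarea formula for a `C¹` function, on its regular points. -/

section Coarea

lemma coe_mk'_orthogonal_eq {V : Type*} [NormedAddCommGroup V] [InnerProductSpace ℝ V] {e : V} (he : ‖e‖ = 1)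
    (x : ℝ) :
    ((AffineSubspace.mk' (x • e +ᵥ (0 : V)) (ℝ ∙ e)ᗮ : AffineSubspace ℝ V) : Set V) =
      {y | ⟪e, y⟫ = x} := by
  ext y
  simp [AffineSubspace.mem_mk', Submodule.mem_orthogonal_singleton_iff_inner_right, inner_sub_right,
    inner_smul_right, he, sub_eq_zero]

/-- Replacing the coordinate of `x` along `e = ∇F(p)/c` by `F(x)/c` turns level sets into
hyperplanes. This map has derivative the identity at `p`, so near `p` it distorts distances by a
factor as close to `1` as desired. -/
lemma exists_bilipschitz_straightening {V : Type*} [NormedAddCommGroup V] [InnerProductSpace ℝ V]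
    [FiniteDimensional ℝ V] {F : V → ℝ} (hF : ContDiff ℝ 1 F) {p : V}
    (hp : gradient F p ≠ 0) {K : ℝ≥0} (hK : 1 < K) :
    ∃ U, IsOpen U ∧ p ∈ U ∧ ∃ (e : V) (c : ℝ) (Ψ : V → V), ‖e‖ = 1 ∧ 0 < c ∧ Continuous Ψ ∧
      (∀ x, ⟪e, Ψ x⟫ = F x / c) ∧ LipschitzOnWith K Ψ U ∧
      (∀ x ∈ U, ∀ y ∈ U, edist x y ≤ K * edist (Ψ x) (Ψ y)) ∧
      ∀ x ∈ U, c ≤ K * ‖gradient F x‖ ∧ ‖gradient F x‖ ≤ K * c := by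
  set c := ‖gradient F p‖ with hc
  have hc0 : 0 < c := norm_pos_iff.2 hp
  set e := c⁻¹ • gradient F p with he
  have he1 : ‖e‖ = 1 := by rw [he, norm_smul, ← hc, norm_inv, Real.norm_of_nonneg hc0.le, inv_mul_cancel₀ hc0.ne']
  have hK1 : (1 : ℝ) < K := hK
  have hK0 : (0 : ℝ) < K := by linarith
  let Ψ : V → V := fun x => x + (F x / c - ⟪e, x⟫) • e
  have hΨ : HasStrictFDerivAt Ψ (ContinuousLinearMap.id ℝ V) p := by
    have h1 := hF.contDiffAt.hasStrictFDerivAt (x := p) (by norm_num)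
    have h2 := (hasStrictFDerivAt_id p).add
      (((h1.mul_const c⁻¹).sub (innerSL ℝ e).hasStrictFDerivAt).smul_const e)
    have h3 : c⁻¹ • fderiv ℝ F p - innerSL ℝ e = 0 := by
      ext v
      simp [he, gradient]
    rw [h3] at h2
    convert h2 using 1
    · ext x
      simp [Ψ, div_eq_mul_inv]
    · ext x
      simp
  -- With this error bound, `1 - δ = 1/K` is the lower Lipschitz constant and `1 + δ = 2 - 1/K ≤ K`
  -- the upper one.
  set δ : ℝ≥0 := 1 - K⁻¹ with hδ
  have hKi : K⁻¹ < 1 := inv_lt_one_of_one_lt₀ hK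
  have hδ0 : 0 < δ := tsub_pos_of_lt hKi
  have hδr : (δ : ℝ) = 1 - (K : ℝ)⁻¹ := by
    rw [hδ, NNReal.coe_sub hKi.le]; simp
  obtain ⟨s, hs, hsΨ⟩ := hΨ.approximates_deriv_on_nhds (c := δ) (Or.inr hδ0)
  have hgc : Continuous fun x => ‖gradient F x‖ :=
    ((LinearIsometryEquiv.continuous _).comp (hF.continuous_fderiv (by norm_num))).norm
  have hnear : ∀ᶠ x in 𝓝 p, c < K * ‖gradient F x‖ ∧ ‖gradient F x‖ < K * c := by
    have hc1 : c < K * c := by nlinarith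
    refine ((hgc.const_mul (K : ℝ)).continuousAt.eventually (lt_mem_nhds hc1)).and
      (hgc.continuousAt.eventually (gt_mem_nhds hc1))
  obtain ⟨U, hUs, hU, hpU⟩ := mem_nhds_iff.1 (inter_mem hs hnear)
  have hsub (x : V) (hx : x ∈ U) (y : V) (hy : y ∈ U) :
      ‖Ψ x - Ψ y - (x - y)‖ ≤ δ * ‖x - y‖ := hsΨ x (hUs hx).1 y (hUs hy).1
  refine ⟨U, hU, hpU, e, c, Ψ, he1, hc0, ?_, ?_, ?_, ?_, ?_⟩
  · have := hF.continuous
    fun_prop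
  · intro x
    simp [Ψ, inner_add_right, inner_smul_right, he1]
  · refine LipschitzOnWith.of_dist_le_mul fun x hx y hy => ?_
    rw [dist_eq_norm, dist_eq_norm]
    have h1 := norm_add_le (Ψ x - Ψ y - (x - y)) (x - y)
    rw [sub_add_cancel] at h1
    have h2 := hsub x hx y hy
    have h3 : (δ : ℝ) + 1 ≤ K := by
      rw [hδr]
      have : (K : ℝ) * (K : ℝ)⁻¹ = 1 := mul_inv_cancel₀ hK0.ne'
      nlinarith [inv_pos.2 hK0, sq_nonneg ((K : ℝ) - 1)]
    nlinarith [norm_nonneg (x - y)]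
  · intro x hx y hy
    have h1 := norm_sub_norm_le (x - y) (x - y - (Ψ x - Ψ y))
    rw [sub_sub_cancel, norm_sub_rev _ (Ψ x - Ψ y)] at h1
    have h2 := hsub x hx y hy
    rw [hδr] at h2
    have h3 : (K : ℝ)⁻¹ * ‖x - y‖ ≤ ‖Ψ x - Ψ y‖ := by
      linarith
    have h4 : ‖x - y‖ ≤ K * ‖Ψ x - Ψ y‖ := by
      rw [inv_mul_le_iff₀ hK0] at h3
      exact h3
    have h5 : nndist x y ≤ K * nndist (Ψ x) (Ψ y) := by
      rw [← NNReal.coe_le_coe]; push_cast; simpa [dist_eq_norm] using h4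
    simp only [edist_nndist]
    exact_mod_cast h5
  · exact fun x hx => ⟨(hUs hx).2.1.le, (hUs hx).2.2.le⟩

variable {V : Type*} [NormedAddCommGroup V] [InnerProductSpace ℝ V] [FiniteDimensional ℝ V]
  [MeasurableSpace V] [BorelSpace V]

lemma volume_eq_lintegral_slice {e : V} (he : ‖e‖ = 1) {t : Set V} (ht : MeasurableSet t) :
    volume t = ∫⁻ x : ℝ, μHE[finrank ℝ V - 1] (t ∩ {y | ⟪e, y⟫ = x}) := by
  have he0 : e ≠ 0 := by rintro rfl; simp at he
  have h := EuclideanGeometry.euclideanHausdorffMeasure_eq_lintegral (0 : V) he0 ht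
  rw [InnerProductSpace.euclideanHausdorffMeasure_eq_volume] at h
  simp_rw [coe_mk'_orthogonal_eq he] at h
  have : ‖e‖ₑ = 1 := by rw [enorm_eq_nnnorm, show ‖e‖₊ = 1 from NNReal.eq he]; simp
  rw [h, this, one_mul]

lemma measurable_slice {e : V} (he : ‖e‖ = 1) {t : Set V} (ht : MeasurableSet t) :
    Measurable fun x : ℝ => μHE[finrank ℝ V - 1] (t ∩ {y | ⟪e, y⟫ = x}) := by
  have he0 : e ≠ 0 := by rintro rfl; simp at he
  have hrank : finrank ℝ (ℝ ∙ e)ᗮ = finrank ℝ V - 1 := by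
    rw [← (ℝ ∙ e).finrank_add_finrank_orthogonal, finrank_span_singleton he0, Nat.add_sub_cancel_left]
  -- The slice is isometric to a section of a measurable subset of the product `ℝ × eᗮ`, and section
  -- measures depend measurably on the parameter.
  have key (x : ℝ) : μHE[finrank ℝ V - 1] (t ∩ {y | ⟪e, y⟫ = x}) =
      (volume : Measure (ℝ ∙ e)ᗮ)
        (Prod.mk x ⁻¹' {q : ℝ × (ℝ ∙ e)ᗮ | q.1 • e + (q.2 : V) ∈ t}) := by
    have hi : Isometry fun w : (ℝ ∙ e)ᗮ => x • e + (w : V) :=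
      Isometry.of_dist_eq fun a b => by rw [dist_add_left]; rfl
    rw [← InnerProductSpace.euclideanHausdorffMeasure_eq_volume, hrank,
      ← hi.euclideanHausdorffMeasure_image]
    congr 1
    ext y
    simp only [mem_inter_iff, mem_ofPred_eq, mem_image, mem_preimage]
    constructor
    · rintro ⟨hy, hyx⟩
      refine ⟨⟨y - x • e, ?_⟩, by simpa using hy, by simp⟩
      rw [Submodule.mem_orthogonal_singleton_iff_inner_right]
      simp [inner_sub_right, inner_smul_right, he, hyx]
    · rintro ⟨w, hw, rfl⟩
      refine ⟨hw, ?_⟩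
      have := Submodule.mem_orthogonal_singleton_iff_inner_right.1 w.2
      simp [inner_add_right, inner_smul_right, he, this]
  simp_rw [key]
  refine measurable_measure_prodMk_left (ht.preimage ?_)
  fun_prop

lemma euclideanHausdorffMeasure_image_le {X Y : Type*} [EMetricSpace X] [MeasurableSpace X]
    [BorelSpace X] [EMetricSpace Y] [MeasurableSpace Y] [BorelSpace Y] {K : ℝ≥0} {f : X → Y}
    {s : Set X} (h : LipschitzOnWith K f s) (d : ℕ) :
    μHE[d] (f '' s) ≤ (K : ℝ≥0∞) ^ d * μHE[d] s := by
  have := h.hausdorffMeasure_image_le (d := d) (Nat.cast_nonneg d)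
  rw [ENNReal.rpow_natCast] at this
  simp only [euclideanHausdorffMeasure_def, Measure.smul_apply, ENNReal.smul_def, smul_eq_mul]
  calc _ ≤ _ := mul_le_mul_right this _
    _ = _ := by ring

lemma le_euclideanHausdorffMeasure_image {X Y : Type*} [EMetricSpace X] [MeasurableSpace X]
    [BorelSpace X] [EMetricSpace Y] [MeasurableSpace Y] [BorelSpace Y] {K : ℝ≥0} {f : X → Y}
    {s : Set X} (h : ∀ x ∈ s, ∀ y ∈ s, edist x y ≤ K * edist (f x) (f y)) (d : ℕ) :
    μHE[d] s ≤ (K : ℝ≥0∞) ^ d * μHE[d] (f '' s) := by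
  rcases s.eq_empty_or_nonempty with rfl | ⟨x₀, hx₀⟩
  · simp
  have : Nonempty X := ⟨x₀⟩
  have hinj : InjOn f s := fun x hx y hy hxy => by
    have := h x hx y hy
    simpa [hxy] using this
  have hl : LipschitzOnWith K (Function.invFunOn f s) (f '' s) := by
    rintro _ ⟨x, hx, rfl⟩ _ ⟨y, hy, rfl⟩
    rw [hinj.leftInvOn_invFunOn hx, hinj.leftInvOn_invFunOn hy]
    exact h x hx y hy
  have := euclideanHausdorffMeasure_image_le hl d
  rwa [hinj.invFunOn_image subset_rfl] at this

/-- The measure of the part in `A` of the level sets of `F`, and the integral of `‖∇F‖` over `A`,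
are within a factor `C` of a measurable function of the level and of its integral. -/
def LevelSandwich (F : V → ℝ) (C : ℝ≥0∞) (A : Set V) : Prop :=
  ∃ h : ℝ → ℝ≥0∞, Measurable h ∧
    (∀ u, h u ≤ C * μHE[finrank ℝ V - 1] (A ∩ F ⁻¹' {u})) ∧
    (∀ u, μHE[finrank ℝ V - 1] (A ∩ F ⁻¹' {u}) ≤ C * h u) ∧
    ∫⁻ u, h u ≤ C * ∫⁻ x in A, ‖gradient F x‖ₑ ∧
    ∫⁻ x in A, ‖gradient F x‖ₑ ≤ C * ∫⁻ u, h u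

lemma lintegral_comp_div {c : ℝ} (hc : 0 < c) {g : ℝ → ℝ≥0∞} (hg : Measurable g) :
    ∫⁻ u, g (u / c) = ENNReal.ofReal c * ∫⁻ u, g u := by
  have h := lintegral_map (μ := volume) hg (measurable_const_mul c⁻¹)
  rw [Real.map_volume_mul_left (inv_ne_zero hc.ne'), inv_inv, abs_of_pos hc,
    lintegral_smul_measure, smul_eq_mul] at h
  rw [h]
  simp [div_eq_inv_mul]

/-- Fubini for the slices of `Ψ '' A`, transported back. In the exponent, `finrank ℝ V` pays for the
distortion of volume and `1` for the oscillation of `‖∇F‖`; the slices cost only `finrank ℝ V - 1`.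
-/
lemma exists_levelSandwich_nhds {F : V → ℝ} (hF : ContDiff ℝ 1 F) {p : V}
    (hp : gradient F p ≠ 0) {K : ℝ≥0} (hK : 1 < K) :
    ∃ U, IsOpen U ∧ p ∈ U ∧ ∀ A ⊆ U, MeasurableSet A →
      LevelSandwich F ((K : ℝ≥0∞) ^ (finrank ℝ V + 1)) A := by
  obtain ⟨U, hU, hpU, e, c, Ψ, he, hc, hΨc, hΨe, hL, hL', hb⟩ :=
    exists_bilipschitz_straightening hF hp hK
  refine ⟨U, hU, hpU, fun A hAU hA => ?_⟩
  have hK' : (1 : ℝ≥0∞) ≤ K := by exact_mod_cast hK.le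
  set n := finrank ℝ V
  have hinj : InjOn Ψ A := fun x hx y hy hxy => by
    have := hL' x (hAU hx) y (hAU hy)
    simpa [hxy] using this
  have hΨA : MeasurableSet (Ψ '' A) := hA.image_of_continuousOn_injOn hΨc.continuousOn hinj
  have hslice (u : ℝ) : Ψ '' A ∩ {y | ⟪e, y⟫ = u / c} = Ψ '' (A ∩ F ⁻¹' {u}) := by
    ext y
    constructor
    · rintro ⟨⟨x, hx, rfl⟩, hy⟩
      simp only [mem_ofPred_eq, hΨe, div_left_inj' hc.ne'] at hy
      exact ⟨x, ⟨hx, hy⟩, rfl⟩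
    · rintro ⟨x, ⟨hx, hxu⟩, rfl⟩
      exact ⟨⟨x, hx, rfl⟩, by simp only [mem_ofPred_eq, hΨe]; rw [hxu]⟩
  have hvol1 : volume (Ψ '' A) ≤ (K : ℝ≥0∞) ^ n * volume A := by
    simpa only [← InnerProductSpace.euclideanHausdorffMeasure_eq_volume] using
      euclideanHausdorffMeasure_image_le (hL.mono hAU) n
  have hvol2 : volume A ≤ (K : ℝ≥0∞) ^ n * volume (Ψ '' A) := by
    simpa only [← InnerProductSpace.euclideanHausdorffMeasure_eq_volume] using
      le_euclideanHausdorffMeasure_image (fun x hx y hy => hL' x (hAU hx) y (hAU hy)) n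
  have hpow : (K : ℝ≥0∞) ^ (n - 1) ≤ K ^ (n + 1) := pow_le_pow_right₀ hK' (by omega)
  have hg1 (x : V) (hx : x ∈ A) : ENNReal.ofReal c ≤ K * ‖gradient F x‖ₑ := by
    have := ENNReal.ofReal_le_ofReal (hb x (hAU hx)).1
    rwa [ENNReal.ofReal_mul K.coe_nonneg, ofReal_norm, ENNReal.ofReal_coe_nnreal] at this
  have hg2 (x : V) (hx : x ∈ A) : ‖gradient F x‖ₑ ≤ K * ENNReal.ofReal c := by
    have := ENNReal.ofReal_le_ofReal (hb x (hAU hx)).2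
    rwa [ENNReal.ofReal_mul K.coe_nonneg, ofReal_norm, ENNReal.ofReal_coe_nnreal] at this
  have hI1 : ENNReal.ofReal c * volume A ≤ K * ∫⁻ x in A, ‖gradient F x‖ₑ := by
    rw [← lintegral_const_mul' _ _ ENNReal.coe_ne_top, ← setLIntegral_const]
    exact setLIntegral_mono' hA hg1
  have hI2 : ∫⁻ x in A, ‖gradient F x‖ₑ ≤ K * ENNReal.ofReal c * volume A := by
    rw [← setLIntegral_const]
    exact setLIntegral_mono' hA hg2
  have hint : ∫⁻ u, μHE[n - 1] (Ψ '' A ∩ {y | ⟪e, y⟫ = u / c}) =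
      ENNReal.ofReal c * volume (Ψ '' A) := by
    rw [lintegral_comp_div hc (measurable_slice he hΨA), ← volume_eq_lintegral_slice he hΨA]
  refine ⟨fun u => μHE[n - 1] (Ψ '' A ∩ {y | ⟪e, y⟫ = u / c}),
    (measurable_slice he hΨA).comp (measurable_id.div_const c), fun u => ?_, fun u => ?_, ?_, ?_⟩
  · simp only [hslice]
    exact (euclideanHausdorffMeasure_image_le
      (hL.mono (inter_subset_left.trans hAU)) _).trans (by gcongr)
  · simp only [hslice]
    exact (le_euclideanHausdorffMeasure_image
      (fun x hx y hy => hL' x (hAU hx.1) y (hAU hy.1)) _).trans (by gcongr)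
  · rw [hint]
    calc _ ≤ ENNReal.ofReal c * ((K : ℝ≥0∞) ^ n * volume A) := by gcongr
      _ = (K : ℝ≥0∞) ^ n * (ENNReal.ofReal c * volume A) := by ring
      _ ≤ (K : ℝ≥0∞) ^ n * (K * ∫⁻ x in A, ‖gradient F x‖ₑ) := by gcongr
      _ = _ := by ring
  · rw [hint]
    calc _ ≤ _ := hI2
      _ ≤ K * ENNReal.ofReal c * ((K : ℝ≥0∞) ^ n * volume (Ψ '' A)) := by gcongr
      _ = _ := by ring

/-- The four inequalities are countably additive in `A` with the same constant, so a countable cover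
by the local neighbourhoods, made disjoint, suffices. -/
lemma exists_levelSandwich {F : V → ℝ} (hF : ContDiff ℝ 1 F) {K : ℝ≥0} (hK : 1 < K) {A : Set V}
    (hA : MeasurableSet A) (hAr : ∀ x ∈ A, gradient F x ≠ 0) :
    LevelSandwich F ((K : ℝ≥0∞) ^ (finrank ℝ V + 1)) A := by
  choose! U hU hpU hs using fun p (hp : gradient F p ≠ 0) => exists_levelSandwich_nhds hF hp hK
  obtain ⟨t, htA, htc, ht⟩ := TopologicalSpace.countable_cover_nhdsWithin (s := A)
    (fun x hx => mem_nhdsWithin_of_mem_nhds ((hU x (hAr x hx)).mem_nhds (hpU x (hAr x hx))))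
  rcases t.eq_empty_or_nonempty with rfl | htn
  · obtain rfl : A = ∅ := by simpa using ht
    exact ⟨0, measurable_const, by simp⟩
  obtain ⟨f, rfl⟩ := htc.exists_eq_range htn
  have hf (n : ℕ) : gradient F (f n) ≠ 0 := hAr _ (htA ⟨n, rfl⟩)
  set B : ℕ → Set V := fun n => A ∩ disjointed (U ∘ f) n with hB
  have hBm (n : ℕ) : MeasurableSet (B n) :=
    hA.inter (MeasurableSet.disjointed (fun i => (hU _ (hf i)).measurableSet) n)
  have hBd : Pairwise (Function.onFun Disjoint B) := fun i j hij =>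
    (disjoint_disjointed (U ∘ f) hij).mono inter_subset_right inter_subset_right
  have hBU : ⋃ n, B n = A := by
    rw [hB, ← inter_iUnion, iUnion_disjointed, inter_eq_left]
    simpa using ht
  choose h hm h1 h2 h3 h4 using fun n => hs (f n) (hf n) (B n)
    (inter_subset_right.trans (disjointed_subset _ _)) (hBm n)
  have hHu (u : ℝ) : μHE[finrank ℝ V - 1] (A ∩ F ⁻¹' {u}) =
      ∑' n, μHE[finrank ℝ V - 1] (B n ∩ F ⁻¹' {u}) := by
    rw [← hBU, iUnion_inter]
    exact measure_iUnion (fun i j hij => (hBd hij).mono inter_subset_left inter_subset_left)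
      fun n => (hBm n).inter (hF.continuous.measurable (measurableSet_singleton u))
  have hI : ∫⁻ x in A, ‖gradient F x‖ₑ = ∑' n, ∫⁻ x in B n, ‖gradient F x‖ₑ := by
    rw [← lintegral_iUnion hBm hBd, hBU]
  refine ⟨fun u => ∑' n, h n u, Measurable.tsum hm, fun u => ?_, fun u => ?_, ?_, ?_⟩
  · rw [hHu, ← ENNReal.tsum_mul_left]
    exact ENNReal.tsum_le_tsum fun n => h1 n u
  · rw [hHu, ← ENNReal.tsum_mul_left]
    exact ENNReal.tsum_le_tsum fun n => h2 n u
  · rw [hI, ← ENNReal.tsum_mul_left, lintegral_tsum fun n => (hm n).aemeasurable]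
    exact ENNReal.tsum_le_tsum h3
  · rw [hI, lintegral_tsum fun n => (hm n).aemeasurable, ← ENNReal.tsum_mul_left]
    exact ENNReal.tsum_le_tsum h4

/-- The coarea formula for sets of regular points. -/
lemma measurable_level_and_lintegral_eq {F : V → ℝ} (hF : ContDiff ℝ 1 F) {A : Set V}
    (hA : MeasurableSet A) (hAr : ∀ x ∈ A, gradient F x ≠ 0) :
    (Measurable fun u => μHE[finrank ℝ V - 1] (A ∩ F ⁻¹' {u})) ∧
      ∫⁻ u, μHE[finrank ℝ V - 1] (A ∩ F ⁻¹' {u}) = ∫⁻ x in A, ‖gradient F x‖ₑ := by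
  set K : ℕ → ℝ≥0 := fun m => 1 + 1 / ((m : ℝ≥0) + 1) with hKdef
  have hK (m : ℕ) : 1 < K m := by simp only [hKdef, lt_add_iff_pos_right]; positivity
  set C : ℕ → ℝ≥0∞ := fun m => (K m : ℝ≥0∞) ^ (finrank ℝ V + 1) with hC
  have hKlim : Tendsto K atTop (𝓝 1) := by
    simpa [hKdef] using (tendsto_const_nhds (x := (1 : ℝ≥0))).add
      (tendsto_one_div_add_atTop_nhds_zero_nat (𝕜 := ℝ≥0))
  have hClim : Tendsto C atTop (𝓝 1) := by
    have : Tendsto (fun m => ((K m ^ (finrank ℝ V + 1) : ℝ≥0) : ℝ≥0∞)) atTop (𝓝 ((1 : ℝ≥0) : ℝ≥0∞)) :=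
      ENNReal.tendsto_coe.2 (by simpa using hKlim.pow (finrank ℝ V + 1))
    simpa [hC] using this
  have hC2 (a : ℝ≥0∞) : Tendsto (fun m => C m * (C m * a)) atTop (𝓝 a) := by
    have h1 : Tendsto (fun m => C m * a) atTop (𝓝 (1 * a)) :=
      ENNReal.Tendsto.mul_const hClim (Or.inl one_ne_zero)
    have h2 := ENNReal.Tendsto.mul hClim (Or.inl one_ne_zero) h1 (Or.inr ENNReal.one_ne_top)
    simpa using h2
  choose h hm h1 h2 h3 h4 using fun m => exists_levelSandwich hF (hK m) hA hAr
  -- The measure of the level is at most `C h`, which is at most `C²` times that measure, and `C →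
  -- 1`. Its measurability in `u`, not known beforehand, follows from this limit.
  have hlim (u : ℝ) : Tendsto (fun m => C m * h m u) atTop
      (𝓝 (μHE[finrank ℝ V - 1] (A ∩ F ⁻¹' {u}))) :=
    tendsto_of_tendsto_of_tendsto_of_le_of_le tendsto_const_nhds (hC2 _)
      (fun m => h2 m u) (fun m => mul_le_mul_right (h1 m u) _)
  have hHm : Measurable fun u => μHE[finrank ℝ V - 1] (A ∩ F ⁻¹' {u}) :=
    measurable_of_tendsto_metrizable (fun m => (hm m).const_mul (C m)) (tendsto_pi_nhds.2 hlim)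
  refine ⟨hHm, le_antisymm ?_ ?_⟩
  · refine ge_of_tendsto (hC2 _) (Eventually.of_forall fun m => ?_)
    calc _ ≤ ∫⁻ u, C m * h m u := lintegral_mono (h2 m)
      _ = C m * ∫⁻ u, h m u := lintegral_const_mul _ (hm m)
      _ ≤ _ := mul_le_mul_right (h3 m) _
  · refine ge_of_tendsto (hC2 _) (Eventually.of_forall fun m => ?_)
    calc _ ≤ _ := h4 m
      _ ≤ C m * ∫⁻ u, C m * μHE[finrank ℝ V - 1] (A ∩ F ⁻¹' {u}) :=
        mul_le_mul_right (lintegral_mono (h1 m)) _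
      _ = _ := by rw [lintegral_const_mul _ hHm]

lemma measurableSet_regular {F : V → ℝ} (hF : ContDiff ℝ 1 F) :
    MeasurableSet {x | gradient F x ≠ 0} := by
  have : Continuous (gradient F) :=
    (LinearIsometryEquiv.continuous _).comp (hF.continuous_fderiv (by norm_num))
  exact (isClosed_eq this continuous_const).measurableSet.compl

/-- Surface measure on the regular part of the level set `{F = u}`. -/
noncomputable def levelMeasure (F : V → ℝ) (u : ℝ) : Measure V :=
  μHE[finrank ℝ V - 1].restrict (F ⁻¹' {u} ∩ {x | gradient F x ≠ 0})

lemma measurable_levelMeasure {F : V → ℝ} (hF : ContDiff ℝ 1 F) : Measurable (levelMeasure F) := by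
  refine measurable_of_measurable_coe _ fun s hs => ?_
  convert (measurable_level_and_lintegral_eq hF (hs.inter (measurableSet_regular hF))
    fun x hx => hx.2).1 using 2 with u
  rw [levelMeasure, Measure.restrict_apply hs, inter_assoc, inter_comm {x | _}]

/-- The coarea formula for nonnegative functions on the set of regular points. -/
lemma lintegral_levelMeasure {F : V → ℝ} (hF : ContDiff ℝ 1 F) {g : V → ℝ≥0∞}
    (hg : Measurable g) :
    ∫⁻ u, ∫⁻ x, g x ∂levelMeasure F u = ∫⁻ x, ‖gradient F x‖ₑ * g x := by
  have hgm : Measurable fun x => ‖gradient F x‖ₑ :=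
    ((LinearIsometryEquiv.continuous _).comp (hF.continuous_fderiv (by norm_num))).measurable.enorm
  -- The formula for sets is an identity of measures; the critical set is invisible on the left by
  -- restriction and on the right because the density vanishes.
  have hk : volume.bind (levelMeasure F) = volume.withDensity fun x => ‖gradient F x‖ₑ := by
    ext s hs
    rw [bind_apply hs (measurable_levelMeasure hF).aemeasurable, withDensity_apply _ hs]
    have h1 := (measurable_level_and_lintegral_eq hF (hs.inter (measurableSet_regular hF))
      fun x hx => hx.2).2
    have h2 : ∫⁻ x in s \ {x | gradient F x ≠ 0}, ‖gradient F x‖ₑ = 0 := by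
      rw [setLIntegral_congr_fun (g := fun _ => 0) (hs.diff (measurableSet_regular hF))]
      · simp
      · intro x hx
        simpa using hx.2
    rw [← lintegral_inter_add_sdiff _ s (measurableSet_regular hF), h2, add_zero, ← h1]
    congr with u
    rw [levelMeasure, Measure.restrict_apply hs, inter_assoc, inter_comm {x | _}]
  rw [← lintegral_bind (measurable_levelMeasure hF).aemeasurable hg.aemeasurable, hk,
    lintegral_withDensity_eq_lintegral_mul _ hgm hg]
  rfl

end Coarea

/-! ### Critical points on almost every level: an Eilenberg-type inequality. -/

section Critical

lemma exists_lipschitz_scale {V : Type*} [NormedAddCommGroup V] [InnerProductSpace ℝ V]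
    [FiniteDimensional ℝ V] {F : V → ℝ} (hF : ContDiff ℝ 1 F) {A : Set V} (hA : IsCompact A)
    (hAc : ∀ x ∈ A, gradient F x = 0) {ε : ℝ≥0} (hε : 0 < ε) :
    ∃ δ : ℝ≥0∞, 0 < δ ∧ ∀ t : Set V, Metric.ediam t ≤ δ →
      Metric.ediam (F '' (A ∩ t)) ≤ ε * Metric.ediam t := by
  have hgc : Continuous (gradient F) :=
    (LinearIsometryEquiv.continuous _).comp (hF.continuous_fderiv (by norm_num))
  obtain ⟨δ, hδ, hsub⟩ := hA.exists_thickening_subset_open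
    (isOpen_lt hgc.norm continuous_const : IsOpen {x | ‖gradient F x‖ < ε})
    fun x hx => by simpa [hAc x hx] using hε
  -- Halving puts any second point of `t` in the open `δ`-ball around the first, where `‖∇F‖ < ε`.
  refine ⟨ENNReal.ofReal (δ / 2), by simpa using hδ, fun t ht => ?_⟩
  refine Metric.ediam_le ?_
  rintro _ ⟨x, ⟨hxA, hxt⟩, rfl⟩ _ ⟨y, ⟨-, hyt⟩, rfl⟩
  have hxy : edist x y ≤ ENNReal.ofReal (δ / 2) := (Metric.edist_le_ediam_of_mem hxt hyt).trans ht
  rw [edist_dist, ENNReal.ofReal_le_ofReal_iff (by positivity)] at hxy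
  have h := (convex_ball x δ).norm_image_sub_le_of_norm_fderiv_le (𝕜 := ℝ) (f := F) (C := ε)
    (fun z _ => (hF.differentiable (by norm_num)).differentiableAt)
    (fun z hz => ?_) (Metric.mem_ball_self hδ)
    (show y ∈ Metric.ball x δ by rw [Metric.mem_ball, dist_comm]; linarith)
  · calc edist (F x) (F y) ≤ ε * edist x y := by
          rw [edist_nndist, edist_nndist]
          have : nndist (F x) (F y) ≤ ε * nndist x y := by
            rw [← NNReal.coe_le_coe]
            push_cast
            rw [dist_comm, dist_comm x, dist_eq_norm, dist_eq_norm]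
            exact h
          exact_mod_cast this
      _ ≤ _ := by gcongr; exact Metric.edist_le_ediam_of_mem hxt hyt
  · have := hsub (Metric.mem_thickening_iff.2 ⟨x, hxA, hz⟩)
    simp only [mem_ofPred_eq, gradient, LinearIsometryEquiv.norm_map] at this
    exact this.le

variable {V : Type*} [NormedAddCommGroup V] [InnerProductSpace ℝ V] [FiniteDimensional ℝ V]
  [MeasurableSpace V] [BorelSpace V]

lemma exists_cover_critical {F : V → ℝ} (hF : ContDiff ℝ 1 F) {A : Set V} (hA : IsCompact A)
    (hAc : ∀ x ∈ A, gradient F x = 0) {ε : ℝ≥0} (hε : 0 < ε) :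
    ∃ t : ℕ → Set V, A ⊆ ⋃ i, t i ∧ (∀ i, Metric.ediam (t i) ≤ ε) ∧
      (∀ i, Metric.ediam (F '' (A ∩ t i)) ≤ ε * Metric.ediam (t i)) ∧
      ∑' i, ⨆ _ : (t i).Nonempty, Metric.ediam (t i) ^ finrank ℝ V ≤ μH[finrank ℝ V] A + 1 := by
  obtain ⟨δ, hδ, h⟩ := exists_lipschitz_scale hF hA hAc hε
  have : (μH[finrank ℝ V] : Measure V).IsAddHaarMeasure := isAddHaarMeasure_hausdorffMeasure
  have hlt : μH[finrank ℝ V] A < μH[finrank ℝ V] A + 1 :=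
    ENNReal.lt_add_right hA.measure_lt_top.ne one_ne_zero
  have hle : (⨅ (t : ℕ → Set V) (_ : A ⊆ ⋃ n, t n) (_ : ∀ n, Metric.ediam (t n) ≤ min δ ε),
      ∑' n, ⨆ _ : (t n).Nonempty, Metric.ediam (t n) ^ (finrank ℝ V : ℝ)) ≤ μH[finrank ℝ V] A := by
    rw [hausdorffMeasure_apply]
    exact le_iSup₂_of_le (min δ ε) (lt_min hδ (by exact_mod_cast hε)) le_rfl
  have hlt' := hle.trans_lt hlt
  simp only [iInf_lt_iff, ENNReal.rpow_natCast] at hlt'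
  obtain ⟨t, ht1, ht2, ht3⟩ := hlt'
  exact ⟨t, ht1, fun i => (ht2 i).trans (min_le_right _ _),
    fun i => h _ ((ht2 i).trans (min_le_left _ _)), ht3.le⟩

/-- Cover `A` by small sets `t i` on which `F` varies by at most `ε diam (t i)`. Those whose image
meets `u` cover the level, and integrating their `d`-dimensional size over `u` costs a further
factor `ε diam (t i)`, for a total of at most `ε (H(A) + 1)`. Fatou's lemma as `ε → 0` concludes.
Only `C¹` regularity is needed, unlike in Sard's theorem. -/
lemma ae_level_compact_critical {F : V → ℝ} (hF : ContDiff ℝ 1 F) (hV : 0 < finrank ℝ V)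
    {A : Set V} (hA : IsCompact A) (hAc : ∀ x ∈ A, gradient F x = 0) :
    ∀ᵐ u, μHE[finrank ℝ V - 1] (A ∩ F ⁻¹' {u}) = 0 := by
  set d := finrank ℝ V - 1 with hd
  have hdn : finrank ℝ V = d + 1 := by omega
  set ε : ℕ → ℝ≥0 := fun m => 1 / ((m : ℝ≥0) + 1) with hε
  have hεlim : Tendsto (fun m => (ε m : ℝ≥0∞)) atTop (𝓝 0) :=
    ENNReal.tendsto_coe.2 (tendsto_one_div_add_atTop_nhds_zero_nat (𝕜 := ℝ≥0))
  choose t h1 h2 h3 h4 using fun m => exists_cover_critical hF hA hAc (ε := ε m) (by positivity)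
  -- The closure makes the image measurable without changing its diameter.
  set I : ℕ → ℕ → Set ℝ := fun m i => closure (F '' (A ∩ t m i)) with hI
  set h : ℕ → ℝ → ℝ≥0∞ := fun m u =>
    ∑' i, (I m i).indicator (fun _ => Metric.ediam (t m i) ^ d) u with hh
  have hIm (m i : ℕ) : MeasurableSet (I m i) := isClosed_closure.measurableSet
  have hhm (m : ℕ) : Measurable (h m) :=
    Measurable.tsum fun i => measurable_const.indicator (hIm m i)
  set M := μH[finrank ℝ V] A + 1 with hM
  have hMtop : M ≠ ∞ := by
    have : (μH[finrank ℝ V] : Measure V).IsAddHaarMeasure := isAddHaarMeasure_hausdorffMeasure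
    exact ENNReal.add_ne_top.2 ⟨hA.measure_lt_top.ne, ENNReal.one_ne_top⟩
  have hint (m : ℕ) : ∫⁻ u, h m u ≤ ε m * M := by
    rw [lintegral_tsum fun i => (measurable_const.indicator (hIm m i)).aemeasurable]
    refine le_trans ?_ (mul_le_mul_right (h4 m) _)
    rw [← ENNReal.tsum_mul_left]
    refine ENNReal.tsum_le_tsum fun i => ?_
    rw [lintegral_indicator_const (hIm m i)]
    rcases (t m i).eq_empty_or_nonempty with he | hne
    · simp [hI, he]
    · rw [ciSup_pos hne, hdn, pow_succ]
      calc Metric.ediam (t m i) ^ d * volume (I m i)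
          ≤ Metric.ediam (t m i) ^ d * (ε m * Metric.ediam (t m i)) := by
            gcongr
            refine (Real.volume_le_diam _).trans ?_
            rw [hI, Metric.ediam_closure]
            exact h3 m i
        _ = _ := by ring
  have hle (u : ℝ) : μH[d] (A ∩ F ⁻¹' {u}) ≤ liminf (fun m => h m u) atTop := by
    have := hausdorffMeasure_le_liminf_tsum (d := d) (A ∩ F ⁻¹' {u}) (l := atTop)
      (ι := fun m => {i : ℕ // u ∈ I m i}) (fun m => (ε m : ℝ≥0∞)) hεlim (fun m i => t m i)
      (Eventually.of_forall fun m i => h2 m i) (Eventually.of_forall fun m x hx => ?_)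
    · refine this.trans_eq (congrArg (fun f => liminf f atTop) (funext fun m => ?_))
      simp only [ENNReal.rpow_natCast, hh]
      exact tsum_subtype {i : ℕ | u ∈ I m i} fun i => Metric.ediam (t m i) ^ d
    · obtain ⟨i, hi⟩ := mem_iUnion.1 (h1 m hx.1)
      exact mem_iUnion.2 ⟨⟨i, subset_closure ⟨x, ⟨hx.1, hi⟩, hx.2⟩⟩, hi⟩
  have hzero : ∫⁻ u, liminf (fun m => h m u) atTop = 0 := by
    refine le_antisymm ((lintegral_liminf_le hhm).trans ?_) zero_le
    have hlim : Tendsto (fun m => (ε m : ℝ≥0∞) * M) atTop (𝓝 0) := by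
      simpa using ENNReal.Tendsto.mul_const hεlim (Or.inr hMtop)
    rw [← hlim.liminf_eq]
    exact liminf_le_liminf (Eventually.of_forall hint)
  rw [lintegral_eq_zero_iff (Measurable.liminf hhm)] at hzero
  filter_upwards [hzero] with u hu
  have h0 : μH[d] (A ∩ F ⁻¹' {u}) = 0 := le_antisymm ((hle u).trans_eq hu) zero_le
  simp [euclideanHausdorffMeasure_def, h0]

/-- Almost every level set has a critical part which is null for surface measure. -/
lemma ae_level_critical {F : V → ℝ} (hF : ContDiff ℝ 1 F) (hV : 0 < finrank ℝ V) :
    ∀ᵐ u, μHE[finrank ℝ V - 1] ({x | gradient F x = 0} ∩ F ⁻¹' {u}) = 0 := by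
  have hgc : Continuous (gradient F) :=
    (LinearIsometryEquiv.continuous _).comp (hF.continuous_fderiv (by norm_num))
  have h (n : ℕ) := ae_level_compact_critical hF hV
    (A := {x | gradient F x = 0} ∩ Metric.closedBall 0 n)
    ((isCompact_closedBall 0 (n : ℝ)).inter_left (isClosed_eq hgc continuous_const)) fun x hx => hx.1
  filter_upwards [ae_all_iff.2 h] with u hu
  refine measure_mono_null ?_ (measure_iUnion_null hu)
  intro x hx
  obtain ⟨n, hn⟩ := exists_nat_ge ‖x‖
  exact mem_iUnion.2 ⟨n, ⟨hx.1, by simpa using hn⟩, hx.2⟩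

end Critical

/-! ### The Gaussian measure has density `gaussDensity`. -/

section Gaussian

lemma gaussDensity_pos {k : ℕ} (x : EuclideanSpace ℝ (Fin k)) : 0 < gaussDensity k x := by
  unfold gaussDensity
  positivity

lemma contDiff_gaussDensity {k : ℕ} : ContDiff ℝ 2 (gaussDensity k) :=
  contDiff_const.mul (Real.contDiff_exp.comp ((contDiff_norm_sq ℝ).neg.div_const _))

lemma continuous_gaussDensity {k : ℕ} : Continuous (gaussDensity k) :=
  contDiff_gaussDensity.continuous

lemma ofReal_gaussDensity_mul_cexp {k : ℕ} (x t : EuclideanSpace ℝ (Fin k)) :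
    (gaussDensity k x : ℂ) * Complex.exp (⟪x, t⟫ * Complex.I) =
      ((2 * Real.pi : ℝ) ^ (-(k : ℝ) / 2) : ℝ) *
        Complex.exp (-(1 / 2 : ℂ) * ‖x‖ ^ 2 + Complex.I * ⟪t, x⟫) := by
  rw [gaussDensity, Complex.ofReal_mul, mul_assoc, Complex.ofReal_exp, ← Complex.exp_add,
    real_inner_comm]
  push_cast
  ring_nf

lemma integrable_gaussDensity {k : ℕ} : Integrable (gaussDensity k) := by
  have h := (GaussianFourier.integrable_cexp_neg_mul_sq_norm_add (b := 1 / 2) (by norm_num)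
    Complex.I (0 : EuclideanSpace ℝ (Fin k))).const_mul
      (((2 * Real.pi : ℝ) ^ (-(k : ℝ) / 2) : ℝ) : ℂ)
  simp_rw [← ofReal_gaussDensity_mul_cexp] at h
  simpa using h.re

lemma gauss_eq_withDensity (k : ℕ) :
    gauss k = volume.withDensity fun x => ENNReal.ofReal (gaussDensity k x) := by
  have : IsFiniteMeasure (volume.withDensity fun x => ENNReal.ofReal (gaussDensity k x)) :=
    isFiniteMeasure_withDensity_ofReal integrable_gaussDensity.2
  refine Measure.ext_of_charFun (funext fun t => ?_)
  rw [charFun_stdGaussian, charFun_apply, integral_withDensity_eq_integral_toReal_smul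
    continuous_gaussDensity.measurable.ennreal_ofReal (by simp)]
  simp_rw [ENNReal.toReal_ofReal (gaussDensity_pos _).le, Complex.real_smul,
    ofReal_gaussDensity_mul_cexp]
  rw [integral_const_mul, GaussianFourier.integral_cexp_neg_mul_sq_norm_add (by norm_num)]
  have h2π : (0 : ℝ) < 2 * Real.pi := by positivity
  have h1 : ((Real.pi : ℂ) / (1 / 2)) ^ (finrank ℝ (EuclideanSpace ℝ (Fin k)) / 2 : ℂ) =
      ((2 * Real.pi : ℝ) ^ ((k : ℝ) / 2) : ℝ) := by
    rw [Complex.ofReal_cpow h2π.le, finrank_euclideanSpace_fin]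
    push_cast
    ring_nf
  rw [h1, ← mul_assoc, ← Complex.ofReal_mul, ← Real.rpow_add h2π, show -(k : ℝ) / 2 + k / 2 = 0 by ring,
    Real.rpow_zero, Complex.ofReal_one, one_mul, Complex.I_sq]
  congr 1
  ring

lemma lintegral_gauss {k : ℕ} {g : EuclideanSpace ℝ (Fin k) → ℝ≥0∞} (hg : Measurable g) :
    ∫⁻ x, g x ∂gauss k = ∫⁻ x, ENNReal.ofReal (gaussDensity k x) * g x := by
  rw [gauss_eq_withDensity, lintegral_withDensity_eq_lintegral_mul _
    continuous_gaussDensity.measurable.ennreal_ofReal hg]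
  rfl

end Gaussian

/-! ### Gradient, Hessian and the vanishing of `G₂` at critical points. -/

section Derivatives

variable {k : ℕ} {F : EuclideanSpace ℝ (Fin k) → ℝ}

lemma hess_eq (x v : EuclideanSpace ℝ (Fin k)) : hess F x v = fderiv ℝ (fderiv ℝ F) x v v := by
  rw [hess, iteratedFDeriv_two_apply]
  rfl

lemma inner_gradient {V : Type*} [NormedAddCommGroup V] [InnerProductSpace ℝ V] [CompleteSpace V]
    (F : V → ℝ) (x v : V) : ⟪gradient F x, v⟫ = fderiv ℝ F x v := by
  simp [gradient]

lemma contDiffAt_gradient {V : Type*} [NormedAddCommGroup V] [InnerProductSpace ℝ V]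
    [CompleteSpace V] {F : V → ℝ} {x : V} (hF : ContDiffAt ℝ 2 F x) :
    ContDiffAt ℝ 1 (gradient F) x :=
  (LinearIsometryEquiv.contDiff _).contDiffAt.comp x (hF.fderiv_right (m := 1) (by norm_num))

lemma contDiff_gradient {V : Type*} [NormedAddCommGroup V] [InnerProductSpace ℝ V]
    [CompleteSpace V] {F : V → ℝ} (hF : ContDiff ℝ 2 F) : ContDiff ℝ 1 (gradient F) :=
  contDiff_iff_contDiffAt.2 fun _ => contDiffAt_gradient hF.contDiffAt

lemma inner_fderiv_gradient {V : Type*} [NormedAddCommGroup V] [InnerProductSpace ℝ V]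
    [CompleteSpace V] {F : V → ℝ} {x : V} (hF : ContDiffAt ℝ 2 F x) (v w : V) :
    ⟪fderiv ℝ (gradient F) x v, w⟫ = fderiv ℝ (fderiv ℝ F) x v w := by
  have h1 := ((hF.fderiv_right (m := 1) (by norm_num)).differentiableAt (by norm_num)).hasFDerivAt
  have h2 := h1.clm_apply (hasFDerivAt_const w x)
  have h3 := ((contDiffAt_gradient hF).differentiableAt (by norm_num)).hasFDerivAt.inner ℝ
    (hasFDerivAt_const w x)
  simp_rw [inner_gradient] at h3
  simpa using congrArg (fun L => L v) (h3.unique h2)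

lemma ornsteinUhlenbeck_eq (x : EuclideanSpace ℝ (Fin k)) :
    ornsteinUhlenbeck F x = ∑ i, fderiv ℝ (fderiv ℝ F) x (EuclideanSpace.single i 1)
      (EuclideanSpace.single i 1) - fderiv ℝ F x x := by
  unfold ornsteinUhlenbeck
  simp_rw [hess_eq]
  congr 1
  have h := congrArg (fderiv ℝ F x) ((EuclideanSpace.basisFun (Fin k) ℝ).sum_repr x)
  rw [← h, _root_.map_sum]
  simp [mul_comm]

lemma continuous_hess (hF : ContDiff ℝ 2 F) {v : EuclideanSpace ℝ (Fin k) → EuclideanSpace ℝ (Fin k)}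
    (hv : Continuous v) : Continuous fun x => hess F x (v x) := by
  simp_rw [hess_eq]
  have h : Continuous (fderiv ℝ (fderiv ℝ F)) :=
    (hF.fderiv_right (m := 1) (by norm_num)).continuous_fderiv (by norm_num)
  fun_prop

lemma measurable_curvatureIntegrand (hF : ContDiff ℝ 2 F) : Measurable (curvatureIntegrand F) := by
  have h1 : Continuous (ornsteinUhlenbeck F) := by
    unfold ornsteinUhlenbeck
    have h2 : Continuous (fderiv ℝ F) := hF.continuous_fderiv (by norm_num)
    have h3 (i : Fin k) := continuous_hess hF (v := fun _ => EuclideanSpace.single i 1)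
      continuous_const
    fun_prop
  have h2 := continuous_hess hF (contDiff_gradient hF).continuous
  have h3 := (contDiff_gradient hF).continuous.norm
  exact h1.measurable.neg.add (h2.measurable.div (h3.measurable.pow_const 2))

lemma measurable_surfaceIntegrand (hF : ContDiff ℝ 2 F) : Measurable (surfaceIntegrand F) :=
  (contDiff_gradient hF).continuous.norm.measurable

/-- The gradient is constant on the critical set, so its derivative, the Hessian, vanishes at almost
every point of that set. -/
lemma ae_curvatureIntegrand_eq_zero (hF : ContDiff ℝ 2 F) :
    ∀ᵐ x, gradient F x = 0 → curvatureIntegrand F x = 0 := by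
  have hs : MeasurableSet {x | gradient F x = 0} :=
    (isClosed_eq (contDiff_gradient hF).continuous continuous_const).measurableSet
  have happ : ApproximatesLinearOn (gradient F) (0 : _ →L[ℝ] EuclideanSpace ℝ (Fin k))
      {x | gradient F x = 0} 0 := by
    intro x hx y hy
    simp only [mem_ofPred_eq] at hx hy
    simp [hx, hy]
  have h := happ.norm_fderiv_sub_le volume hs (fderiv ℝ (gradient F)) fun x _ =>
    ((contDiff_gradient hF).differentiable (by norm_num)).differentiableAt.hasFDerivAt.hasFDerivWithinAt
  rw [ae_restrict_iff' hs] at h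
  filter_upwards [h] with x hx hx0
  have h0 := hx hx0
  simp only [sub_zero, nonpos_iff_eq_zero, nnnorm_eq_zero] at h0
  have h1 : fderiv ℝ (fderiv ℝ F) x = 0 := by
    ext v w
    rw [← inner_fderiv_gradient hF.contDiffAt, h0]
    simp
  have h2 : fderiv ℝ F x = 0 := by
    ext v
    rw [← inner_gradient, hx0, inner_zero_left]
    rfl
  simp [curvatureIntegrand, ornsteinUhlenbeck_eq, hess_eq, h1, h2]

end Derivatives

/-! ### Half-spaces, determinants and traces. -/

section LinearAlgebra

variable {V : Type*} [NormedAddCommGroup V] [InnerProductSpace ℝ V]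

/-- Testing `-a` gives `⟪a, b⟫ ≥ 0`; testing the component of `b` orthogonal to `a`, allowed after
passing to the closed half-space, forces equality in Cauchy–Schwarz. -/
lemma smul_eq_smul_of_halfspace {a b : V} (ha : a ≠ 0)
    (h : ∀ v, ⟪a, v⟫ < 0 → ⟪b, v⟫ ≤ 0) : ‖b‖ • a = ‖a‖ • b := by
  have ha0 : 0 < ‖a‖ := norm_pos_iff.2 ha
  have h' (v : V) (hv : ⟪a, v⟫ ≤ 0) : ⟪b, v⟫ ≤ 0 := by
    have hlim : Tendsto (fun ε : ℝ => ⟪b, v - ε • a⟫) (𝓝[>] 0) (𝓝 ⟪b, v⟫) := by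
      have : Continuous fun ε : ℝ => ⟪b, v - ε • a⟫ := by fun_prop
      simpa using (this.tendsto 0).mono_left nhdsWithin_le_nhds
    refine le_of_tendsto hlim (eventually_mem_nhdsWithin.mono fun ε hε => h _ ?_)
    rw [inner_sub_right, inner_smul_right, real_inner_self_eq_norm_sq]
    have : 0 < ε * ‖a‖ ^ 2 := mul_pos hε (by positivity)
    linarith
  have h1 : 0 ≤ ⟪a, b⟫ := by
    have := h (-a) (by rw [inner_neg_right, real_inner_self_eq_norm_sq]; nlinarith)
    rw [inner_neg_right, real_inner_comm] at this
    linarith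
  have h2 := h' (b - (⟪a, b⟫ / ‖a‖ ^ 2) • a) (le_of_eq (by
    rw [inner_sub_right, inner_smul_right, real_inner_self_eq_norm_sq]
    field_simp
    ring))
  rw [inner_sub_right, inner_smul_right, real_inner_self_eq_norm_sq, real_inner_comm a b] at h2
  have h3 : ‖b‖ ^ 2 * ‖a‖ ^ 2 ≤ ⟪a, b⟫ ^ 2 := by
    have : (‖b‖ ^ 2 - ⟪a, b⟫ / ‖a‖ ^ 2 * ⟪a, b⟫) * ‖a‖ ^ 2 ≤ 0 :=
      mul_nonpos_of_nonpos_of_nonneg h2 (by positivity)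
    field_simp at this
    nlinarith
  refine inner_eq_norm_mul_iff_real.1 (le_antisymm (real_inner_le_norm a b) ?_)
  refine le_of_sq_le_sq ?_ h1
  nlinarith

variable [FiniteDimensional ℝ V]

lemma hasDerivAt_det_one_sub_smul (A : V →L[ℝ] V) :
    HasDerivAt (fun r : ℝ => (1 - r • A : V →L[ℝ] V).det) (-LinearMap.trace ℝ V A) 0 := by
  let b := finBasis ℝ V
  have h (r : ℝ) : (1 - r • A : V →L[ℝ] V).det =
      (1 + r • (-LinearMap.toMatrix b b A)).det := by
    rw [ContinuousLinearMap.det, ← LinearMap.det_toMatrix b]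
    congr 1
    have : ((1 - r • A : V →L[ℝ] V) : V →ₗ[ℝ] V) = LinearMap.id - r • (A : V →ₗ[ℝ] V) := rfl
    rw [this, map_sub, LinearMap.toMatrix_id, map_smul, smul_neg, sub_eq_add_neg]
  refine HasDerivAt.congr_of_eventuallyEq ?_
    (Eventually.of_forall fun r => (h r).trans (Matrix.det_one_add_smul r _))
  rw [Matrix.trace_neg, ← LinearMap.trace_eq_matrix_trace ℝ b]
  have aux (a : ℝ) (q : Polynomial ℝ) :
      HasDerivAt (fun r : ℝ => 1 + a * r + q.eval r * r ^ 2) a 0 := by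
    have h := (((hasDerivAt_id (0 : ℝ)).const_mul a).const_add 1).add
      ((q.hasDerivAt 0).mul ((hasDerivAt_id (0 : ℝ)).pow 2))
    exact h.congr_deriv (by simp)
  exact aux _ _

/-- Cyclicity of the trace and `P ∘ P = P` reduce the left side to the trace of `A ∘ P`. -/
lemma trace_starProjection_conj (a : V) (A : V →L[ℝ] V) :
    LinearMap.trace ℝ V ((ℝ ∙ a)ᗮ.starProjection ∘L A ∘L (ℝ ∙ a)ᗮ.starProjection : V →L[ℝ] V) =
      LinearMap.trace ℝ V A - ⟪a, A a⟫ / ‖a‖ ^ 2 := by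
  set P := (ℝ ∙ a)ᗮ.starProjection
  have hPP : P ∘L P = P := by
    ext v
    exact Submodule.starProjection_eq_self_iff.2 (Submodule.starProjection_apply_mem _ v)
  have hP (v : V) : P v = v - (⟪a, v⟫ / ‖a‖ ^ 2) • a := by
    have := Submodule.starProjection_orthogonal_val (K := ℝ ∙ a) v
    rw [this, Submodule.starProjection_singleton]
    simp
  have h1 : LinearMap.trace ℝ V (P ∘L A ∘L P : V →L[ℝ] V) =
      LinearMap.trace ℝ V ((A : V →ₗ[ℝ] V) * (P : V →ₗ[ℝ] V)) := by
    have : ((P ∘L A ∘L P : V →L[ℝ] V) : V →ₗ[ℝ] V) =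
        (P : V →ₗ[ℝ] V) * ((A : V →ₗ[ℝ] V) * (P : V →ₗ[ℝ] V)) := rfl
    rw [this, LinearMap.trace_mul_comm, mul_assoc]
    congr 2
    ext v
    exact congrArg (fun L : V →L[ℝ] V => L v) hPP
  rw [h1]
  let b := stdOrthonormalBasis ℝ V
  rw [LinearMap.trace_eq_sum_inner _ b, LinearMap.trace_eq_sum_inner _ b]
  have h2 (i) : ⟪b i, ((A : V →ₗ[ℝ] V) * (P : V →ₗ[ℝ] V)) (b i)⟫ =
      ⟪b i, (A : V →ₗ[ℝ] V) (b i)⟫ - ⟪a, b i⟫ * ⟪b i, A a⟫ / ‖a‖ ^ 2 := by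
    simp only [Module.End.mul_apply, ContinuousLinearMap.coe_coe, hP, map_sub, map_smul,
      inner_sub_right, inner_smul_right]
    ring
  simp_rw [h2, Finset.sum_sub_distrib, ← Finset.sum_div, b.sum_inner_mul_inner]

end LinearAlgebra

/-- By the implicit function theorem, tangent vectors are velocities of curves in the level set;
such curves determine derivatives along the boundary. -/
lemma exists_curve_levelSet {V : Type*} [NormedAddCommGroup V] [InnerProductSpace ℝ V]
    [FiniteDimensional ℝ V] {F : V → ℝ} {p v : V} (hF : ContDiffAt ℝ 1 F p)
    (hp : gradient F p ≠ 0) (hv : ⟪gradient F p, v⟫ = 0) :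
    ∃ γ : ℝ → V, γ 0 = p ∧ HasDerivAt γ v 0 ∧ ∀ᶠ t in 𝓝 0, F (γ t) = F p := by
  have hs := hF.hasStrictFDerivAt (by norm_num)
  have hr : (fderiv ℝ F p).range = ⊤ := by
    refine LinearMap.range_eq_top.2 (LinearMap.surjective fun h0 => hp ?_)
    have : fderiv ℝ F p = 0 := ContinuousLinearMap.coe_injective h0
    simp [gradient, this]
  let w : (fderiv ℝ F p).ker := ⟨v, by simpa [inner_gradient] using hv⟩
  refine ⟨fun t => hs.implicitFunction F (fderiv ℝ F p) hr (F p) (t • w), ?_, ?_, ?_⟩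
  · simp
  · have h1 := (hs.to_implicitFunction hr).hasFDerivAt
    have h2 : HasDerivAt (fun t : ℝ => t • w) w 0 := by
      simpa using (hasDerivAt_id (0 : ℝ)).smul_const w
    rw [← zero_smul ℝ w] at h1
    exact h1.comp_hasDerivAt (0 : ℝ) h2
  · have h1 := hs.map_implicitFunction_eq hr
    have h2 : Tendsto (fun t : ℝ => (F p, t • w)) (𝓝 0) (𝓝 (F p, 0)) := by
      have : Continuous fun t : ℝ => (F p, t • w) := by fun_prop
      simpa using this.tendsto 0
    exact h2.eventually h1

/-! ### The outward normal does not depend on the defining function. -/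

section LocalDefining

variable {k : ℕ} {D : Set (EuclideanSpace ℝ (Fin k))} {p : EuclideanSpace ℝ (Fin k)}

lemma IsLocalDefining.eq_zero {g : EuclideanSpace ℝ (Fin k) → ℝ} (hg : IsLocalDefining D p g)
    (hp : p ∈ frontier D) : g p = 0 := by
  obtain ⟨hc, -, hD⟩ := hg
  rw [frontier_eq_closure_inter_closure] at hp
  by_contra hne
  rcases lt_or_gt_of_ne hne with h | h
  · have h1 := (hc.continuousAt.eventually (gt_mem_nhds h)).and hD
    obtain ⟨x, hxD, hx1, hx2⟩ := (mem_closure_iff_frequently.1 hp.2).and_eventually h1 |>.exists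
    exact hxD (hx2.2 hx1.le)
  · have h1 := (hc.continuousAt.eventually (lt_mem_nhds h)).and hD
    obtain ⟨x, hxD, hx1, hx2⟩ := (mem_closure_iff_frequently.1 hp.1).and_eventually h1 |>.exists
    exact absurd (hx2.1 hxD) (not_le.2 hx1)

lemma hasDerivAt_comp_line {g : EuclideanSpace ℝ (Fin k) → ℝ} (hg : DifferentiableAt ℝ g p)
    (v : EuclideanSpace ℝ (Fin k)) :
    HasDerivAt (fun t : ℝ => g (p + t • v)) ⟪gradient g p, v⟫ 0 := by
  have h1 : HasDerivAt (fun t : ℝ => p + t • v) v 0 := by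
    simpa using ((hasDerivAt_id (0 : ℝ)).smul_const v).const_add p
  have h2 : HasFDerivAt g (fderiv ℝ g p) (p + (0 : ℝ) • v) := by simpa using hg.hasFDerivAt
  rw [inner_gradient]
  exact h2.comp_hasDerivAt (0 : ℝ) h1

/-- A ray from `p` along which `g₁` decreases enters `D`, where `g₂ ≤ 0 = g₂ p`. -/
lemma IsLocalDefining.halfspace {g₁ g₂ : EuclideanSpace ℝ (Fin k) → ℝ}
    (h₁ : IsLocalDefining D p g₁) (h₂ : IsLocalDefining D p g₂) (hp : p ∈ frontier D)
    (v : EuclideanSpace ℝ (Fin k)) (hv : ⟪gradient g₁ p, v⟫ < 0) : ⟪gradient g₂ p, v⟫ ≤ 0 := by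
  have hz₁ := h₁.eq_zero hp
  have hz₂ := h₂.eq_zero hp
  have hd₁ := hasDerivAt_comp_line (h₁.1.differentiableAt (by norm_num)) v
  have hd₂ := hasDerivAt_comp_line (h₂.1.differentiableAt (by norm_num)) v
  have hline : Tendsto (fun t : ℝ => p + t • v) (𝓝[>] 0) (𝓝 p) := by
    have : Continuous fun t : ℝ => p + t • v := by fun_prop
    simpa using (this.tendsto 0).mono_left nhdsWithin_le_nhds
  have hs₁ := hd₁.hasDerivWithinAt (s := Ioi 0)
  have hs₂ := hd₂.hasDerivWithinAt (s := Ioi 0)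
  rw [hasDerivWithinAt_iff_tendsto_slope' (by simp)] at hs₁ hs₂
  refine le_of_tendsto hs₂ ?_
  filter_upwards [hs₁.eventually (gt_mem_nhds hv), hline.eventually h₁.2.2,
    hline.eventually h₂.2.2, eventually_mem_nhdsWithin] with t ht ht₁ ht₂ ht0
  have ht0' : (0 : ℝ) < t := ht0
  simp only [slope_def_field, zero_smul, add_zero, hz₁, hz₂, sub_zero] at ht ⊢
  have h3 : g₁ (p + t • v) ≤ 0 := by
    by_contra! hcon
    exact absurd ht (not_lt.2 (div_nonneg hcon.le ht0'.le))
  exact div_nonpos_of_nonpos_of_nonneg (ht₂.1 (ht₁.2 h3)) ht0'.le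

lemma outwardNormal_eq {g : EuclideanSpace ℝ (Fin k) → ℝ} (hg : IsLocalDefining D p g)
    (hp : p ∈ frontier D) : outwardNormal D p = ‖gradient g p‖⁻¹ • gradient g p := by
  have hex : ∃ g, IsLocalDefining D p g := ⟨g, hg⟩
  rw [outwardNormal, dif_pos hex]
  have hc := hex.choose_spec
  have h := smul_eq_smul_of_halfspace hg.2.1 (hg.halfspace hc hp)
  have h1 : ‖gradient g p‖ ≠ 0 := norm_ne_zero_iff.2 hg.2.1
  have h2 : ‖gradient hex.choose p‖ ≠ 0 := norm_ne_zero_iff.2 hc.2.1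
  rw [inv_smul_eq_iff₀ h2, smul_comm, h, smul_smul, inv_mul_cancel₀ h1, one_smul]

end LocalDefining

/-! ### Normal, shape operator and tube integrands of an excursion set. -/

section LevelSet

variable {k : ℕ} {F : EuclideanSpace ℝ (Fin k) → ℝ} {u : ℝ} {p : EuclideanSpace ℝ (Fin k)}

lemma frontier_excursionSet_subset (hF : Continuous F) :
    frontier (excursionSet F u) ⊆ F ⁻¹' {u} := by
  intro x hx
  have := hF.frontier_preimage_subset (Ici u) hx
  simpa using this

lemma gradient_const_sub (F : EuclideanSpace ℝ (Fin k) → ℝ) (u : ℝ) (x : EuclideanSpace ℝ (Fin k)) :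
    gradient (fun y => u - F y) x = -gradient F x := by
  simp [gradient, fderiv_const_sub]

lemma isLocalDefining_excursionSet (hF : ContDiff ℝ 2 F) (hp : gradient F p ≠ 0) :
    IsLocalDefining (excursionSet F u) p fun x => u - F x :=
  ⟨(contDiff_const.sub hF).contDiffAt, by simpa [gradient_const_sub] using hp,
    Eventually.of_forall fun x => by simp [excursionSet]⟩

lemma mem_frontier_excursionSet (hF : ContDiff ℝ 2 F) (hp : gradient F p ≠ 0) (hpu : F p = u) :
    p ∈ frontier (excursionSet F u) := by
  rw [frontier_eq_closure_inter_closure]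
  refine ⟨subset_closure (by simp [excursionSet, hpu]), ?_⟩
  have hd := hasDerivAt_comp_line (hF.contDiffAt.differentiableAt (x := p) (by norm_num))
    (-gradient F p)
  have hneg : ⟪gradient F p, -gradient F p⟫ < 0 := by
    rw [inner_neg_right, real_inner_self_eq_norm_sq, neg_lt_zero]
    positivity
  have hs := hd.hasDerivWithinAt (s := Ioi 0)
  rw [hasDerivWithinAt_iff_tendsto_slope' (by simp)] at hs
  have hline : Tendsto (fun t : ℝ => p + t • -gradient F p) (𝓝[>] 0) (𝓝 p) := by
    have : Continuous fun t : ℝ => p + t • -gradient F p := by fun_prop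
    simpa using (this.tendsto 0).mono_left nhdsWithin_le_nhds
  refine mem_closure_of_tendsto hline ?_
  filter_upwards [hs.eventually (gt_mem_nhds hneg), eventually_mem_nhdsWithin] with t ht ht0
  have ht0' : (0 : ℝ) < t := ht0
  simp only [slope_def_field, zero_smul, add_zero, hpu, sub_zero] at ht
  simp only [excursionSet, mem_compl_iff, mem_preimage, mem_Ici, not_le]
  rw [div_neg_iff] at ht
  rcases ht with ht | ht <;> linarith [ht.1, ht.2]

lemma outwardNormal_excursionSet (hF : ContDiff ℝ 2 F) (hp : gradient F p ≠ 0) (hpu : F p = u) :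
    outwardNormal (excursionSet F u) p = -(‖gradient F p‖⁻¹ • gradient F p) := by
  rw [outwardNormal_eq (isLocalDefining_excursionSet hF hp) (mem_frontier_excursionSet hF hp hpu),
    gradient_const_sub, norm_neg, smul_neg]

/-- The term `c • ∇F`, from differentiating `‖∇F‖⁻¹`, is left unspecified because the projection in
the shape operator kills it. -/
lemma fderivWithin_outwardNormal_apply (hF : ContDiff ℝ 2 F) (hp : gradient F p ≠ 0) (hpu : F p = u)
    {v : EuclideanSpace ℝ (Fin k)} (hv : ⟪gradient F p, v⟫ = 0) :
    ∃ c : ℝ, fderivWithin ℝ (outwardNormal (excursionSet F u)) (frontier (excursionSet F u)) p v =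
      -(‖gradient F p‖⁻¹ • fderiv ℝ (gradient F) p v) + c • gradient F p := by
  have hg : HasFDerivAt (gradient F) (fderiv ℝ (gradient F) p) p :=
    ((contDiff_gradient hF).differentiable (by norm_num)).differentiableAt.hasFDerivAt
  have hn : DifferentiableAt ℝ (fun x => ‖gradient F x‖⁻¹) p :=
    (hg.differentiableAt.norm ℝ hp).inv (norm_ne_zero_iff.2 hp)
  have hN := (hn.hasFDerivAt.smul hg).neg
  have hreg : ∀ᶠ x in 𝓝 p, gradient F x ≠ 0 := hg.continuousAt.eventually_ne hp
  have hW := hN.hasFDerivWithinAt (s := frontier (excursionSet F u)) |>.congr_of_eventuallyEq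
    (f₁ := outwardNormal (excursionSet F u)) (by
      filter_upwards [nhdsWithin_le_nhds hreg, self_mem_nhdsWithin] with x hx hxu
      rw [outwardNormal_excursionSet hF hx (frontier_excursionSet_subset hF.continuous hxu)]
      rfl) (by rw [outwardNormal_excursionSet hF hp hpu]; rfl)
  have hW' := hW.differentiableWithinAt.hasFDerivWithinAt
  obtain ⟨γ, hγ0, hγ, hγF⟩ := exists_curve_levelSet (hF.of_le (by norm_num)).contDiffAt hp hv
  have hγmem : ∀ᶠ t in 𝓝 (0 : ℝ), γ t ∈ frontier (excursionSet F u) := by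
    have := hγ.continuousAt.tendsto
    rw [hγ0] at this
    filter_upwards [hγF, this.eventually hreg] with t h1 h2
    exact mem_frontier_excursionSet hF h2 (h1.trans hpu)
  -- A derivative within the boundary need not be unique, but any two agree on `v`, the velocity of
  -- a curve in the boundary.
  have key (L : EuclideanSpace ℝ (Fin k) →L[ℝ] EuclideanSpace ℝ (Fin k))
      (hL : HasFDerivWithinAt (outwardNormal (excursionSet F u)) L
        (frontier (excursionSet F u)) p) :
      HasDerivAt (fun t => outwardNormal (excursionSet F u) (γ t)) (L v) 0 := by
    rw [← hγ0] at hL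
    obtain ⟨s, hs, hs0⟩ := eventually_nhds_iff.1 hγmem
    have := hL.comp_hasDerivWithinAt (0 : ℝ) (hγ.hasDerivWithinAt (s := s)) hs
    exact this.hasDerivAt (hs0.1.mem_nhds hs0.2)
  refine ⟨-(fderiv ℝ (fun x => ‖gradient F x‖⁻¹) p v), ?_⟩
  rw [(key _ hW').unique (key _ hW)]
  simp only [_root_.neg_apply, _root_.add_apply,
    _root_.smul_apply, ContinuousLinearMap.smulRight_apply, neg_add, neg_smul]

lemma shapeOperator_excursionSet (hF : ContDiff ℝ 2 F) (hp : gradient F p ≠ 0) (hpu : F p = u) :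
    shapeOperator (excursionSet F u) p =
      ‖gradient F p‖⁻¹ • ((ℝ ∙ gradient F p)ᗮ.starProjection ∘L fderiv ℝ (gradient F) p ∘L
        (ℝ ∙ gradient F p)ᗮ.starProjection) := by
  have hspan : (ℝ ∙ outwardNormal (excursionSet F u) p) = ℝ ∙ gradient F p := by
    rw [outwardNormal_excursionSet hF hp hpu, ← smul_neg, ← neg_smul_neg, neg_neg]
    exact Submodule.span_singleton_smul_eq
      (IsUnit.mk0 _ (neg_ne_zero.2 (inv_ne_zero (norm_ne_zero_iff.2 hp)))) _
  simp only [shapeOperator, hspan]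
  set P := (ℝ ∙ gradient F p)ᗮ.starProjection
  have hPg : P (gradient F p) = 0 := by
    rw [Submodule.starProjection_apply_eq_zero_iff]
    exact Submodule.le_orthogonal_orthogonal _ (Submodule.mem_span_singleton_self _)
  ext1 v
  have hPv : ⟪gradient F p, P v⟫ = 0 :=
    Submodule.mem_orthogonal_singleton_iff_inner_right.1 (Submodule.starProjection_apply_mem _ v)
  obtain ⟨c, hc⟩ := fderivWithin_outwardNormal_apply hF hp hpu hPv
  simp [hc, hPg]

lemma minkowskiDensity_one (D : Set (EuclideanSpace ℝ (Fin k))) (p : EuclideanSpace ℝ (Fin k)) :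
    minkowskiDensity D 1 p = 1 := by
  simp [minkowskiDensity, ContinuousLinearMap.det]

lemma minkowskiDensity_two (hF : ContDiff ℝ 2 F) (hp : gradient F p ≠ 0) (hpu : F p = u) :
    minkowskiDensity (excursionSet F u) 2 p =
      ‖gradient F p‖⁻¹ * (-∑ i, fderiv ℝ (fderiv ℝ F) p (EuclideanSpace.single i 1)
        (EuclideanSpace.single i 1) + hess F p (gradient F p) / ‖gradient F p‖ ^ 2) := by
  rw [minkowskiDensity, Nat.add_one_sub_one, iteratedDeriv_one,
    (hasDerivAt_det_one_sub_smul _).deriv, shapeOperator_excursionSet hF hp hpu,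
    ContinuousLinearMap.toLinearMap_smul, map_smul, trace_starProjection_conj, hess_eq,
    ← inner_fderiv_gradient hF.contDiffAt,
    LinearMap.trace_eq_sum_inner _ (EuclideanSpace.basisFun (Fin k) ℝ)]
  simp_rw [← inner_fderiv_gradient hF.contDiffAt (EuclideanSpace.single _ _)]
  simp only [EuclideanSpace.basisFun_apply, ContinuousLinearMap.coe_coe, smul_eq_mul,
    real_inner_comm (EuclideanSpace.single _ (1 : ℝ)), real_inner_comm (gradient F p)]
  ring

lemma tubeCoeffIntegrand_one (D : Set (EuclideanSpace ℝ (Fin k)))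
    (φ : EuclideanSpace ℝ (Fin k) → ℝ) : tubeCoeffIntegrand D φ 1 p = φ p := by
  simp [tubeCoeffIntegrand, minkowskiDensity_one]

lemma gradient_gaussDensity (p : EuclideanSpace ℝ (Fin k)) :
    gradient (gaussDensity k) p = -(gaussDensity k p • p) := by
  have h1 : HasFDerivAt (fun x : EuclideanSpace ℝ (Fin k) => -‖x‖ ^ 2 / 2)
      (-(innerSL ℝ p)) p := by
    refine (((hasStrictFDerivAt_norm_sq p).hasFDerivAt.const_mul (-2⁻¹ : ℝ)).congr_of_eventuallyEq
      (Eventually.of_forall fun x => by ring)).congr_fderiv ?_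
    ext v
    simp
  have h2 := (h1.exp).const_mul ((2 * Real.pi) ^ (-(k : ℝ) / 2))
  refine ext_inner_right ℝ fun v => ?_
  have h3 : fderiv ℝ (gaussDensity k) p = _ := h2.fderiv
  rw [inner_gradient, h3]
  simp [gaussDensity, inner_smul_left]
  ring

/-- As `∇φ(p) = -φ(p) p`, the normal derivative of `φ` is `φ ⟪p, ∇F⟫/‖∇F‖`, the drift part of `-LF`;
the term `-tr S_p` supplies the rest. -/
lemma tubeCoeffIntegrand_two (hF : ContDiff ℝ 2 F) (hp : gradient F p ≠ 0) (hpu : F p = u) :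
    tubeCoeffIntegrand (excursionSet F u) (gaussDensity k) 2 p =
      gaussDensity k p * (curvatureIntegrand F p / ‖gradient F p‖) := by
  have h1 := (hasDerivAt_comp_line (contDiff_gaussDensity.contDiffAt.differentiableAt (x := p)
    (by norm_num)) (outwardNormal (excursionSet F u) p)).deriv
  have h2 : deriv (fun t : ℝ => gaussDensity k (p + t • outwardNormal (excursionSet F u) p)) 0 =
      gaussDensity k p * (‖gradient F p‖⁻¹ * fderiv ℝ F p p) := by
    rw [h1, outwardNormal_excursionSet hF hp hpu, gradient_gaussDensity, ← inner_gradient,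
      real_inner_comm p]
    simp [inner_smul_right]
    ring
  simp only [tubeCoeffIntegrand, Finset.sum_range_succ, Finset.sum_range_zero, zero_add,
    Nat.add_one_sub_one, Nat.choose_self, Nat.choose_zero_right, Nat.cast_one, one_mul,
    Nat.sub_zero, Nat.sub_self, iteratedDeriv_one, iteratedDeriv_zero, zero_smul, add_zero, h2,
    minkowskiDensity_one, mul_one, Nat.reduceAdd, minkowskiDensity_two hF hp hpu,
    curvatureIntegrand, ornsteinUhlenbeck_eq]
  ring

end LevelSet

/-! ### Level integrals as densities, compared with conditional expectations. -/

section Disintegration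

lemma ae_eq_of_subset_of_null_sdiff {α : Type*} [MeasurableSpace α] {μ : Measure α} {s t : Set α}
    (h : s ⊆ t) (h0 : μ (t \ s) = 0) : s =ᵐ[μ] t :=
  ae_eq_set.2 ⟨by simp [sdiff_eq_empty.2 h], h0⟩

variable {k : ℕ} {F G : EuclideanSpace ℝ (Fin k) → ℝ}

lemma levelMeasure_eq (F : EuclideanSpace ℝ (Fin k) → ℝ) (u : ℝ) :
    levelMeasure F u = μHE[k - 1].restrict (F ⁻¹' {u} ∩ {x | gradient F x ≠ 0}) := by
  rw [levelMeasure, finrank_euclideanSpace_fin]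

lemma measurableSet_regular_level (hF : ContDiff ℝ 2 F) (u : ℝ) :
    MeasurableSet (F ⁻¹' {u} ∩ {x | gradient F x ≠ 0}) :=
  (hF.continuous.measurable (measurableSet_singleton u)).inter
    (measurableSet_regular (hF.of_le (by norm_num)))

lemma ae_levelMeasure (hF : ContDiff ℝ 2 F) (u : ℝ) :
    ∀ᵐ x ∂levelMeasure F u, F x = u ∧ gradient F x ≠ 0 := by
  rw [levelMeasure]
  exact ae_restrict_mem (measurableSet_regular_level hF u)

/-- The boundary contains the regular part of the level, and what remains is critical, hence null
for almost every `u`. For `k = 0` the truncated dimension `k - 1` is `0`, but the boundary is empty.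
-/
lemma ae_restrict_frontier_eq (hF : ContDiff ℝ 2 F) :
    ∀ᵐ u, μHE[k - 1].restrict (frontier (excursionSet F u)) = levelMeasure F u := by
  have hsub (u : ℝ) : F ⁻¹' {u} ∩ {x | gradient F x ≠ 0} ⊆ frontier (excursionSet F u) :=
    fun x hx => mem_frontier_excursionSet hF hx.2 hx.1
  rcases Nat.eq_zero_or_pos k with rfl | hk
  · refine Eventually.of_forall fun u => ?_
    have h0 : frontier (excursionSet F u) = ∅ := (isClopen_discrete _).frontier_eq
    rw [levelMeasure_eq, h0, subset_empty_iff.1 ((hsub u).trans h0.subset)]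
  · have := ae_level_critical (hF.of_le (m := 1) (by norm_num))
      (by rwa [finrank_euclideanSpace_fin])
    rw [finrank_euclideanSpace_fin] at this
    filter_upwards [this] with u hu
    rw [levelMeasure_eq]
    refine Measure.restrict_congr_set (Filter.EventuallyEq.symm ?_)
    refine ae_eq_of_subset_of_null_sdiff (hsub u) (measure_mono_null ?_ hu)
    rintro x ⟨hx, hx'⟩
    have hxu := frontier_excursionSet_subset hF.continuous hx
    exact ⟨by_contra fun h => hx' ⟨hxu, h⟩, hxu⟩

/-- The integrand over level sets which corresponds to `G` by the coarea formula. -/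
noncomputable def levelIntegrand (F G : EuclideanSpace ℝ (Fin k) → ℝ)
    (x : EuclideanSpace ℝ (Fin k)) : ℝ :=
  gaussDensity k x * (G x / ‖gradient F x‖)

lemma levelIntegrand_neg : levelIntegrand F (-G) = -levelIntegrand F G := by
  ext x
  simp [levelIntegrand, neg_div]

lemma measurable_levelIntegrand (hF : ContDiff ℝ 2 F) (hG : Measurable G) :
    Measurable (levelIntegrand F G) :=
  continuous_gaussDensity.measurable.mul (hG.div (contDiff_gradient hF).continuous.norm.measurable)

/-- The integral of the positive part of the level integrand over the level set. -/
noncomputable def levelLIntegral (F G : EuclideanSpace ℝ (Fin k) → ℝ) (u : ℝ) : ℝ≥0∞ :=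
  ∫⁻ x, ENNReal.ofReal (levelIntegrand F G x) ∂levelMeasure F u

lemma measurable_levelLIntegral (hF : ContDiff ℝ 2 F) (hG : Measurable G) :
    Measurable (levelLIntegral F G) :=
  (Measure.measurable_lintegral (measurable_levelIntegrand hF hG).ennreal_ofReal).comp
    (measurable_levelMeasure (hF.of_le (by norm_num)))

/-- The coarea weight `‖∇F‖` cancels the denominator at regular points; `hG0` accounts for the
critical ones. -/
lemma setLIntegral_levelLIntegral (hF : ContDiff ℝ 2 F) (hG : Measurable G)
    (hG0 : ∀ᵐ x, gradient F x = 0 → G x = 0) {B : Set ℝ} (hB : MeasurableSet B) :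
    ∫⁻ u in B, levelLIntegral F G u = ∫⁻ x in F ⁻¹' B, ENNReal.ofReal (G x) ∂gauss k := by
  have hFB : MeasurableSet (F ⁻¹' B) := hF.continuous.measurable hB
  rw [← lintegral_indicator hB, ← lintegral_indicator hFB,
    lintegral_gauss (hG.ennreal_ofReal.indicator hFB)]
  have h1 (u : ℝ) : B.indicator (levelLIntegral F G) u =
      ∫⁻ x, (F ⁻¹' B).indicator (fun x => ENNReal.ofReal (levelIntegrand F G x)) x
        ∂levelMeasure F u := by
    by_cases hu : u ∈ B
    · rw [indicator_of_mem hu, levelLIntegral]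
      refine lintegral_congr_ae ((ae_levelMeasure hF u).mono fun x hx => ?_)
      exact (indicator_of_mem (s := F ⁻¹' B) (show F x ∈ B from hx.1.symm ▸ hu)
        fun x => ENNReal.ofReal (levelIntegrand F G x)).symm
    · rw [indicator_of_notMem hu]
      symm
      rw [lintegral_eq_zero_iff ((measurable_levelIntegrand hF hG).ennreal_ofReal.indicator hFB)]
      refine (ae_levelMeasure hF u).mono fun x hx => ?_
      exact indicator_of_notMem (s := F ⁻¹' B)
        (f := fun x => ENNReal.ofReal (levelIntegrand F G x)) (fun h => hu (hx.1 ▸ h))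
  simp_rw [h1]
  rw [lintegral_levelMeasure (hF.of_le (by norm_num))
    ((measurable_levelIntegrand hF hG).ennreal_ofReal.indicator hFB)]
  refine lintegral_congr_ae (hG0.mono fun x hx => ?_)
  by_cases hxB : x ∈ F ⁻¹' B
  · simp only [indicator_of_mem hxB]
    by_cases hx0 : gradient F x = 0
    · simp [hx0, hx hx0]
    · rw [← ofReal_norm, ← ENNReal.ofReal_mul (norm_nonneg _),
        ← ENNReal.ofReal_mul (gaussDensity_pos x).le, levelIntegrand]
      congr 1
      have := norm_ne_zero_iff.2 hx0
      field_simp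
  · simp [indicator_of_notMem hxB]

lemma setLIntegral_condLaw (hF : Measurable F) {g : EuclideanSpace ℝ (Fin k) → ℝ≥0∞}
    (hg : Measurable g) {B : Set ℝ} (hB : MeasurableSet B) :
    ∫⁻ u in B, ∫⁻ x, g x ∂condLaw F u ∂((gauss k).map F) = ∫⁻ x in F ⁻¹' B, g x ∂gauss k := by
  have h := compProd_map_condDistrib (X := F) (μ := gauss k) (mβ := Real.measurableSpace) aemeasurable_id
  have h1 := Measure.setLIntegral_compProd (μ := (gauss k).map F)
    (κ := condDistrib id F (gauss k)) (f := fun q : ℝ × EuclideanSpace ℝ (Fin k) => g q.2)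
    (hg.comp measurable_snd) hB MeasurableSet.univ
  rw [h, setLIntegral_map (f := fun q : ℝ × EuclideanSpace ℝ (Fin k) => g q.2)
    (hB.prod MeasurableSet.univ) (hg.comp measurable_snd) (hF.prodMk measurable_id)] at h1
  simp only [Measure.restrict_univ] at h1
  refine h1.symm.trans ?_
  congr 2
  ext x
  simp

/-- The measure `μ` may have a singular part. Test sets are cut down to `S`, which has full Lebesgue
measure and is null for that part. -/
lemma ae_eq_mul_rnDeriv {μ : Measure ℝ} [IsFiniteMeasure μ] {J K : ℝ → ℝ≥0∞} (hJ : Measurable J)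
    (hK : Measurable K)
    (h : ∀ B, MeasurableSet B → ∫⁻ u in B, J u = ∫⁻ u in B, K u ∂μ) :
    ∀ᵐ u, J u = K u * μ.rnDeriv volume u := by
  obtain ⟨S, hS, hS0, hSc⟩ := mutuallySingular_singularPart μ volume
  have hmeas : Measurable (μ.rnDeriv volume) := measurable_rnDeriv μ volume
  refine (withDensity_eq_iff_of_sigmaFinite hJ.aemeasurable (hK.mul hmeas).aemeasurable).1 ?_
  ext B hB
  have hae : (B : Set ℝ) =ᵐ[volume] (B ∩ S : Set ℝ) := by
    refine (ae_eq_of_subset_of_null_sdiff inter_subset_left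
      (measure_mono_null ?_ hSc)).symm
    rintro x ⟨hx, hx'⟩ hxS
    exact hx' ⟨hx, hxS⟩
  rw [withDensity_apply _ hB, withDensity_apply _ hB, setLIntegral_congr hae,
    setLIntegral_congr hae, h _ (hB.inter hS)]
  have hμ : μ.restrict (B ∩ S) = (volume.withDensity (μ.rnDeriv volume)).restrict (B ∩ S) := by
    conv_lhs => rw [μ.haveLebesgueDecomposition_add volume]
    rw [Measure.restrict_add, Measure.restrict_eq_zero.2 (measure_mono_null inter_subset_right hS0),
      zero_add]
  rw [hμ, setLIntegral_withDensity_eq_setLIntegral_mul _ hmeas hK (hB.inter hS)]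
  simp [mul_comm]

lemma ae_levelLIntegral_eq (hF : ContDiff ℝ 2 F) (hG : Measurable G)
    (hG0 : ∀ᵐ x, gradient F x = 0 → G x = 0) :
    ∀ᵐ u, levelLIntegral F G u =
      (∫⁻ x, ENNReal.ofReal (G x) ∂condLaw F u) * pdf F (gauss k) volume u := by
  have hFm : Measurable F := hF.continuous.measurable
  refine ae_eq_mul_rnDeriv (measurable_levelLIntegral hF hG) ?_ fun B hB => ?_
  · exact (Measure.measurable_lintegral hG.ennreal_ofReal).comp
      (condDistrib id F (gauss k)).measurable
  · rw [setLIntegral_levelLIntegral hF hG hG0 hB, setLIntegral_condLaw hFm hG.ennreal_ofReal hB]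

end Disintegration

/-! ### Splitting into positive and negative parts, since `G₂` is signed. -/

section PosNegParts

variable {α : Type*} [MeasurableSpace α] {μ : Measure α} {f : α → ℝ}

lemma integrable_iff_lintegral_parts (hf : Measurable f) :
    Integrable f μ ↔ ∫⁻ x, ENNReal.ofReal (f x) ∂μ ≠ ∞ ∧ ∫⁻ x, ENNReal.ofReal (-f x) ∂μ ≠ ∞ := by
  refine ⟨fun h => ⟨?_, ?_⟩, fun h => ⟨hf.aestronglyMeasurable, ?_⟩⟩
  · exact ((lintegral_mono fun x => Real.ofReal_le_enorm (f x)).trans_lt h.2).ne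
  · exact ((lintegral_mono fun x => Real.ofReal_le_enorm (-f x)).trans_lt h.neg.2).ne
  · have (x : α) : ‖f x‖ₑ = ENNReal.ofReal (f x) + ENNReal.ofReal (-f x) := by
      rw [Real.enorm_eq_ofReal_abs]
      rcases le_total 0 (f x) with h0 | h0
      · simp [abs_of_nonneg h0, ENNReal.ofReal_of_nonpos (neg_nonpos.2 h0)]
      · simp [abs_of_nonpos h0, ENNReal.ofReal_of_nonpos h0]
    rw [HasFiniteIntegral]
    simp_rw [this]
    rw [lintegral_add_left hf.ennreal_ofReal]
    exact ENNReal.add_lt_top.2 ⟨h.1.lt_top, h.2.lt_top⟩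

end PosNegParts

/-! ### The formulas at almost every level. -/

section Formulas

variable {k : ℕ} {F G : EuclideanSpace ℝ (Fin k) → ℝ}

lemma integrable_levelIntegrand_iff (hF : ContDiff ℝ 2 F) (hG : Measurable G) (u : ℝ) :
    Integrable (levelIntegrand F G) (levelMeasure F u) ↔
      levelLIntegral F G u ≠ ∞ ∧ levelLIntegral F (-G) u ≠ ∞ := by
  rw [integrable_iff_lintegral_parts (measurable_levelIntegrand hF hG)]
  simp [levelLIntegral, levelIntegrand_neg]

lemma integral_levelIntegrand_eq {u : ℝ} (h : Integrable (levelIntegrand F G) (levelMeasure F u)) :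
    ∫ x, levelIntegrand F G x ∂levelMeasure F u =
      (levelLIntegral F G u).toReal - (levelLIntegral F (-G) u).toReal := by
  rw [integral_eq_lintegral_pos_part_sub_lintegral_neg_part h]
  simp [levelLIntegral, levelIntegrand_neg]

/-- Both parts of the level integral are finite and equal a conditional integral times the density,
so where the density is nonzero the conditional integrals are finite too. Where `lawDensity` is `0`,
both sides vanish. -/
lemma condMean_formula (hF : ContDiff ℝ 2 F) (hG : Measurable G)
    (hG0 : ∀ᵐ x, gradient F x = 0 → G x = 0) :
    ∀ᵐ u, Integrable (levelIntegrand F G) (levelMeasure F u) →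
      (lawDensity F u ≠ 0 → Integrable G (condLaw F u)) ∧
      ∫ x, levelIntegrand F G x ∂levelMeasure F u = condMean G F u * lawDensity F u := by
  filter_upwards [ae_levelLIntegral_eq hF hG hG0, ae_levelLIntegral_eq hF hG.neg
    (hG0.mono fun x hx h => by simp [hx h])] with u h1 h2 hint
  have hfin := (integrable_levelIntegrand_iff hF hG u).1 hint
  have hI (h0 : lawDensity F u ≠ 0) : Integrable G (condLaw F u) := by
    have h0' : pdf F (gauss k) volume u ≠ 0 := fun h => h0 (by simp [lawDensity, h])
    rw [integrable_iff_lintegral_parts hG]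
    constructor
    · intro h
      rw [h1, h, ENNReal.top_mul h0'] at hfin
      exact hfin.1 rfl
    · intro h
      simp only [Pi.neg_apply] at h2
      rw [h2, h, ENNReal.top_mul h0'] at hfin
      exact hfin.2 rfl
  refine ⟨hI, ?_⟩
  rw [integral_levelIntegrand_eq hint, h1, h2, ENNReal.toReal_mul, ENNReal.toReal_mul, ← sub_mul]
  by_cases h0 : lawDensity F u = 0
  · rw [show (pdf F (gauss k) volume u).toReal = 0 from h0, h0, mul_zero, mul_zero]
  · rw [condMean, integral_eq_lintegral_pos_part_sub_lintegral_neg_part (hI h0)]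
    rfl

lemma ae_gaussMinkowski_eq (hF : ContDiff ℝ 2 F) :
    ∀ᵐ u,
      ((GaussMinkowskiFinite (excursionSet F u) 1 ↔
        Integrable (levelIntegrand F (surfaceIntegrand F)) (levelMeasure F u)) ∧
      gaussMinkowski (excursionSet F u) 1 =
        ∫ x, levelIntegrand F (surfaceIntegrand F) x ∂levelMeasure F u) ∧
      ((GaussMinkowskiFinite (excursionSet F u) 2 ↔
        Integrable (levelIntegrand F (curvatureIntegrand F)) (levelMeasure F u)) ∧
      gaussMinkowski (excursionSet F u) 2 =
        ∫ x, levelIntegrand F (curvatureIntegrand F) x ∂levelMeasure F u) := by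
  filter_upwards [ae_restrict_frontier_eq hF] with u hu
  have h1 : tubeCoeffIntegrand (excursionSet F u) (gaussDensity k) 1 =ᵐ[levelMeasure F u]
      levelIntegrand F (surfaceIntegrand F) := by
    filter_upwards [ae_levelMeasure hF u] with x hx
    rw [tubeCoeffIntegrand_one, levelIntegrand, surfaceIntegrand,
      div_self (norm_ne_zero_iff.2 hx.2), mul_one]
  have h2 : tubeCoeffIntegrand (excursionSet F u) (gaussDensity k) 2 =ᵐ[levelMeasure F u]
      levelIntegrand F (curvatureIntegrand F) := by
    filter_upwards [ae_levelMeasure hF u] with x hx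
    rw [tubeCoeffIntegrand_two hF hx.2 hx.1, levelIntegrand]
  simp only [GaussMinkowskiFinite, gaussMinkowski, tubeCoeff, IntegrableOn, hu, zero_add,
    Nat.reduceAdd]
  exact ⟨⟨integrable_congr h1, integral_congr_ae h1⟩, ⟨integrable_congr h2, integral_congr_ae h2⟩⟩

lemma ae_surfaceIntegrand_eq_zero (F : EuclideanSpace ℝ (Fin k) → ℝ) :
    ∀ᵐ x, gradient F x = 0 → surfaceIntegrand F x = 0 :=
  Eventually.of_forall fun x hx => by simp [surfaceIntegrand, hx]

end Formulas

/-! ### Averaging over shrinking intervals at a continuity point. -/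

section IndividualLevel

variable {k : ℕ} {F G : EuclideanSpace ℝ (Fin k) → ℝ}

lemma tendsto_average_ball {m : ℝ → ℝ} {u : ℝ} (hm : ContinuousAt m u)
    (hi : ∀ᶠ ε in 𝓝[>] (0 : ℝ), IntegrableOn m (Metric.ball u ε)) :
    Tendsto (fun ε : ℝ => (2 * ε)⁻¹ * ∫ z in Metric.ball u ε, m z) (𝓝[>] 0) (𝓝 (m u)) := by
  rw [Metric.tendsto_nhds]
  intro η hη
  obtain ⟨δ, hδ, h⟩ := Metric.continuousAt_iff.1 hm (η / 2) (by positivity)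
  filter_upwards [hi, Ioo_mem_nhdsGT hδ] with ε hε hεδ
  have hε0 : 0 < ε := hεδ.1
  have hvol : volume.real (Metric.ball u ε) = 2 * ε := by
    rw [Measure.real, Real.volume_ball, ENNReal.toReal_ofReal (by positivity)]
  have hsub : (2 * ε)⁻¹ * ∫ z in Metric.ball u ε, m z =
      m u + (2 * ε)⁻¹ * ∫ z in Metric.ball u ε, (m z - m u) := by
    rw [integral_sub hε (integrableOn_const measure_ball_lt_top.ne), setIntegral_const, hvol, smul_eq_mul]
    field_simp
    ring
  have hle : ‖∫ z in Metric.ball u ε, (m z - m u)‖ ≤ η / 2 * (2 * ε) := by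
    rw [← hvol]
    refine norm_setIntegral_le_of_norm_le_const measure_ball_lt_top fun z hz => ?_
    have := h ((Metric.mem_ball.1 hz).trans hεδ.2)
    rw [dist_eq_norm] at this
    exact this.le
  rw [hsub, dist_eq_norm, add_sub_cancel_left, norm_mul, norm_inv,
    Real.norm_of_nonneg (by positivity : (0 : ℝ) ≤ 2 * ε)]
  calc _ ≤ (2 * ε)⁻¹ * (η / 2 * (2 * ε)) := by gcongr
    _ = η / 2 := by field_simp
    _ < η := by linarith

lemma hasCondDensityAt_of_continuousAt (hF : ContDiff ℝ 2 F) (hG : Measurable G)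
    (hG0 : ∀ᵐ x, gradient F x = 0 → G x = 0) {m : ℝ → ℝ} {u : ℝ} (hm : ContinuousAt m u)
    (hmG : ∀ᶠ ε in 𝓝[>] (0 : ℝ), ∀ᵐ z ∂volume.restrict (Metric.ball u ε),
      m z = (levelLIntegral F G z).toReal - (levelLIntegral F (-G) z).toReal)
    (hi : ∀ᶠ ε in 𝓝[>] (0 : ℝ), IntegrableOn G {x | |F x - u| < ε} (gauss k)) :
    HasCondDensityAt G F u (m u) := by
  refine ⟨hi, ?_⟩
  have key : ∀ᶠ ε in 𝓝[>] (0 : ℝ), IntegrableOn m (Metric.ball u ε) ∧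
      ∫ x in {x | |F x - u| < ε}, G x ∂gauss k = ∫ z in Metric.ball u ε, m z := by
    filter_upwards [hi, hmG] with ε hε hεm
    have hset : {x | |F x - u| < ε} = F ⁻¹' Metric.ball u ε := by
      ext x
      simp [Real.dist_eq]
    have hneg : ∀ᵐ x, gradient F x = 0 → (-G) x = 0 := hG0.mono fun x hx h => by simp [hx h]
    have h1 := setLIntegral_levelLIntegral hF hG hG0 (Metric.isOpen_ball (x := u) (ε := ε)).measurableSet
    have h2 := setLIntegral_levelLIntegral hF hG.neg hneg
      (Metric.isOpen_ball (x := u) (ε := ε)).measurableSet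
    rw [hset] at hε ⊢
    have hfin := (integrable_iff_lintegral_parts hG).1 hε
    simp only [Pi.neg_apply] at h2
    rw [← h1, ← h2] at hfin
    have hm1 := (measurable_levelLIntegral hF hG)
    have hm2 := (measurable_levelLIntegral hF hG.neg)
    have hi1 := integrable_toReal_of_lintegral_ne_top hm1.aemeasurable hfin.1
    have hi2 := integrable_toReal_of_lintegral_ne_top hm2.aemeasurable hfin.2
    refine ⟨(hi1.sub hi2).congr (hεm.mono fun z hz => hz.symm), ?_⟩
    rw [integral_eq_lintegral_pos_part_sub_lintegral_neg_part hε, ← h1, ← h2,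
      integral_congr_ae hεm, integral_sub hi1 hi2,
      integral_toReal hm1.aemeasurable (ae_lt_top hm1 hfin.1),
      integral_toReal hm2.aemeasurable (ae_lt_top hm2 hfin.2)]
  refine (tendsto_average_ball hm (key.mono fun ε h => h.1)).congr' ?_
  filter_upwards [key] with ε hε
  rw [hε.2]

end IndividualLevel

/-! ### Cylinders and independence of the dimension. -/

section Cylinder

variable {k n : ℕ}

/-- The map which selects the coordinates `s 0, …, s (k - 1)`. -/
noncomputable def coordMap (s : Fin k → Fin n) :
    EuclideanSpace ℝ (Fin n) →L[ℝ] EuclideanSpace ℝ (Fin k) :=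
  LinearMap.toContinuousLinearMap
    { toFun := fun y => WithLp.toLp 2 fun i => y (s i)
      map_add' := fun _ _ => rfl
      map_smul' := fun _ _ => rfl }

lemma coordMap_apply (s : Fin k → Fin n) (y : EuclideanSpace ℝ (Fin n)) (i : Fin k) :
    coordMap s y i = y (s i) := rfl

lemma cylinder_excursionSet (s : Fin k → Fin n) (F : EuclideanSpace ℝ (Fin k) → ℝ) (u : ℝ) :
    cylinder s (excursionSet F u) = excursionSet (F ∘ coordMap s) u := rfl

lemma coordMap_single_of_injective {s : Fin k → Fin n} (hs : Function.Injective s) (i : Fin k) :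
    coordMap s (EuclideanSpace.single (s i) 1) = EuclideanSpace.single i 1 := by
  ext j
  simp [coordMap_apply, hs.eq_iff]

lemma coordMap_single_of_notMem {s : Fin k → Fin n} {i : Fin n} (hi : i ∉ range s) :
    coordMap s (EuclideanSpace.single i 1) = 0 := by
  ext j
  have : s j ≠ i := fun h => hi ⟨j, h⟩
  simp [coordMap_apply, this]

lemma coordMap_adjoint {s : Fin k → Fin n} (hs : Function.Injective s)
    (a : EuclideanSpace ℝ (Fin k)) : coordMap s (ContinuousLinearMap.adjoint (coordMap s) a) = a := by
  ext j
  have h1 : (ContinuousLinearMap.adjoint (coordMap s) a) (s j) =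
      ⟪EuclideanSpace.single (s j) (1 : ℝ), ContinuousLinearMap.adjoint (coordMap s) a⟫ := by
    rw [EuclideanSpace.inner_single_left, map_one, one_mul]
  rw [coordMap_apply, h1, ContinuousLinearMap.adjoint_inner_right, coordMap_single_of_injective hs,
    EuclideanSpace.inner_single_left, map_one, one_mul]

lemma norm_coordMap_adjoint {s : Fin k → Fin n} (hs : Function.Injective s)
    (a : EuclideanSpace ℝ (Fin k)) : ‖ContinuousLinearMap.adjoint (coordMap s) a‖ = ‖a‖ := by
  rw [← sq_eq_sq₀ (norm_nonneg _) (norm_nonneg _), ← real_inner_self_eq_norm_sq,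
    ContinuousLinearMap.adjoint_inner_right, coordMap_adjoint hs, real_inner_self_eq_norm_sq]

/-- The adjoint of the coordinate map is isometric, so the characteristic functions coincide. -/
lemma map_coordMap_gauss {s : Fin k → Fin n} (hs : Function.Injective s) :
    (gauss n).map (coordMap s) = gauss k := by
  have : IsProbabilityMeasure ((gauss n).map (coordMap s)) :=
    isProbabilityMeasure_map (coordMap s).continuous.aemeasurable
  refine Measure.ext_of_charFun (funext fun t => ?_)
  have h : charFun ((gauss n).map (coordMap s)) t =
      charFun (gauss n) (ContinuousLinearMap.adjoint (coordMap s) t) := by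
    rw [charFun_apply, charFun_apply, integral_map (coordMap s).continuous.aemeasurable
      (by fun_prop)]
    simp_rw [ContinuousLinearMap.adjoint_inner_right]
  rw [h, charFun_stdGaussian, charFun_stdGaussian, norm_coordMap_adjoint hs]

variable {F : EuclideanSpace ℝ (Fin k) → ℝ} {s : Fin k → Fin n}

lemma contDiff_comp_coordMap (hF : ContDiff ℝ 2 F) : ContDiff ℝ 2 (F ∘ coordMap s) :=
  hF.comp (coordMap s).contDiff

lemma fderiv_comp_coordMap (hF : ContDiff ℝ 2 F) (y v : EuclideanSpace ℝ (Fin n)) :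
    fderiv ℝ (F ∘ coordMap s) y v = fderiv ℝ F (coordMap s y) (coordMap s v) := by
  have h := (hF.differentiable (by norm_num)).differentiableAt (x := coordMap s y)
  rw [(h.hasFDerivAt.comp y (coordMap s).hasFDerivAt).fderiv]
  rfl

lemma gradient_comp_coordMap (hF : ContDiff ℝ 2 F) (y : EuclideanSpace ℝ (Fin n)) :
    gradient (F ∘ coordMap s) y =
      ContinuousLinearMap.adjoint (coordMap s) (gradient F (coordMap s y)) := by
  refine ext_inner_right ℝ fun v => ?_
  rw [inner_gradient, fderiv_comp_coordMap hF, ContinuousLinearMap.adjoint_inner_left,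
    inner_gradient]

lemma hess_comp_coordMap (hF : ContDiff ℝ 2 F) (y v : EuclideanSpace ℝ (Fin n)) :
    hess (F ∘ coordMap s) y v = hess F (coordMap s y) (coordMap s v) := by
  have h1 : DifferentiableAt ℝ (fderiv ℝ (F ∘ coordMap s)) y :=
    ((contDiff_comp_coordMap hF).fderiv_right (m := 1) (by norm_num)).contDiffAt.differentiableAt
      (by norm_num)
  have h2 : DifferentiableAt ℝ (fderiv ℝ F) (coordMap s y) :=
    (hF.fderiv_right (m := 1) (by norm_num)).contDiffAt.differentiableAt (by norm_num)
  have h3 := h1.hasFDerivAt.clm_apply (hasFDerivAt_const v y)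
  have h4 := (h2.hasFDerivAt.comp y (coordMap s).hasFDerivAt).clm_apply
    (hasFDerivAt_const (coordMap s v) y)
  simp_rw [fderiv_comp_coordMap hF] at h3
  rw [hess_eq, hess_eq]
  simpa using congrArg (fun L => L v) (h3.unique h4)

lemma ornsteinUhlenbeck_comp_coordMap (hF : ContDiff ℝ 2 F) (hs : Function.Injective s)
    (y : EuclideanSpace ℝ (Fin n)) :
    ornsteinUhlenbeck (F ∘ coordMap s) y = ornsteinUhlenbeck F (coordMap s y) := by
  rw [ornsteinUhlenbeck_eq, ornsteinUhlenbeck_eq, fderiv_comp_coordMap hF]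
  congr 1
  simp_rw [← hess_eq, hess_comp_coordMap hF]
  refine (Fintype.sum_of_injective s hs _ _ (fun i hi => ?_) fun i => ?_).symm
  · rw [coordMap_single_of_notMem hi, hess_eq]
    simp
  · rw [coordMap_single_of_injective hs]

lemma surfaceIntegrand_comp_coordMap (hF : ContDiff ℝ 2 F) (hs : Function.Injective s) :
    surfaceIntegrand (F ∘ coordMap s) = surfaceIntegrand F ∘ coordMap s := by
  ext y
  simp only [surfaceIntegrand, Function.comp_apply]
  rw [gradient_comp_coordMap hF, norm_coordMap_adjoint hs]

lemma curvatureIntegrand_comp_coordMap (hF : ContDiff ℝ 2 F) (hs : Function.Injective s) :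
    curvatureIntegrand (F ∘ coordMap s) = curvatureIntegrand F ∘ coordMap s := by
  ext y
  simp only [curvatureIntegrand, Function.comp_apply]
  rw [ornsteinUhlenbeck_comp_coordMap hF hs, hess_comp_coordMap hF, gradient_comp_coordMap hF,
    norm_coordMap_adjoint hs, coordMap_adjoint hs]

/-- Both sides are Lebesgue densities of `B ↦ E[G⁺; F ∈ B]`, so no surface measure of a cylinder has
to be computed. -/
lemma ae_levelLIntegral_comp_coordMap (hF : ContDiff ℝ 2 F) (hs : Function.Injective s)
    {G : EuclideanSpace ℝ (Fin k) → ℝ} (hG : Measurable G)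
    (hG0 : ∀ᵐ x, gradient F x = 0 → G x = 0)
    (hG0' : ∀ᵐ y, gradient (F ∘ coordMap s) y = 0 → (G ∘ coordMap s) y = 0) :
    ∀ᵐ u, levelLIntegral (F ∘ coordMap s) (G ∘ coordMap s) u = levelLIntegral F G u := by
  have hL : Measurable (coordMap s) := (coordMap s).continuous.measurable
  have hF' := contDiff_comp_coordMap (s := s) hF
  refine (withDensity_eq_iff_of_sigmaFinite
    (measurable_levelLIntegral hF' (hG.comp hL)).aemeasurable
    (measurable_levelLIntegral hF hG).aemeasurable).1 ?_
  ext B hB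
  rw [withDensity_apply _ hB, withDensity_apply _ hB,
    setLIntegral_levelLIntegral hF' (hG.comp hL) hG0' hB, setLIntegral_levelLIntegral hF hG hG0 hB,
    ← map_coordMap_gauss hs, setLIntegral_map (hF.continuous.measurable hB) hG.ennreal_ofReal hL]
  rfl

lemma ae_integral_levelIntegrand_comp_coordMap (hF : ContDiff ℝ 2 F) (hs : Function.Injective s)
    {G : EuclideanSpace ℝ (Fin k) → ℝ} (hG : Measurable G)
    (hG0 : ∀ᵐ x, gradient F x = 0 → G x = 0)
    (hG0' : ∀ᵐ y, gradient (F ∘ coordMap s) y = 0 → (G ∘ coordMap s) y = 0) :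
    ∀ᵐ u, Integrable (levelIntegrand F G) (levelMeasure F u) →
      Integrable (levelIntegrand (F ∘ coordMap s) (G ∘ coordMap s))
        (levelMeasure (F ∘ coordMap s) u) ∧
      ∫ y, levelIntegrand (F ∘ coordMap s) (G ∘ coordMap s) y ∂levelMeasure (F ∘ coordMap s) u =
        ∫ x, levelIntegrand F G x ∂levelMeasure F u := by
  have hL : Measurable (coordMap s) := (coordMap s).continuous.measurable
  filter_upwards [ae_levelLIntegral_comp_coordMap hF hs hG hG0 hG0',
    ae_levelLIntegral_comp_coordMap hF hs hG.neg (hG0.mono fun x hx h => by simp [hx h])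
      (hG0'.mono fun x hx h => by simpa using hx h)] with u h1 h2 hint
  have h2' : levelLIntegral (F ∘ coordMap s) (-(G ∘ coordMap s)) u = levelLIntegral F (-G) u := h2
  have hint' : Integrable (levelIntegrand (F ∘ coordMap s) (G ∘ coordMap s))
      (levelMeasure (F ∘ coordMap s) u) := by
    rw [integrable_levelIntegrand_iff (contDiff_comp_coordMap hF) (hG.comp hL), h1, h2']
    exact (integrable_levelIntegrand_iff hF hG u).1 hint
  refine ⟨hint', ?_⟩
  rw [integral_levelIntegrand_eq hint', integral_levelIntegrand_eq hint, h1, h2']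

lemma gaussMinkowski_zero_cylinder (hs : Function.Injective s) {D : Set (EuclideanSpace ℝ (Fin k))}
    (hD : MeasurableSet D) : gaussMinkowski (cylinder s D) 0 = gaussMinkowski D 0 := by
  rw [gaussMinkowski, gaussMinkowski, ← map_coordMap_gauss hs,
    map_measureReal_apply (coordMap s).continuous.measurable hD]
  rfl

lemma ae_gaussMinkowski_cylinder (hF : ContDiff ℝ 2 F) (hs : Function.Injective s) :
    ∀ᵐ u, GaussMinkowskiFinite (excursionSet F u) 1 → GaussMinkowskiFinite (excursionSet F u) 2 →
      ∀ l ≤ 2, GaussMinkowskiFinite (cylinder s (excursionSet F u)) l ∧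
        gaussMinkowski (cylinder s (excursionSet F u)) l = gaussMinkowski (excursionSet F u) l := by
  have hF' := contDiff_comp_coordMap (s := s) hF
  have hS := ae_surfaceIntegrand_eq_zero (F ∘ coordMap s)
  have hC := ae_curvatureIntegrand_eq_zero hF'
  have hM := ae_gaussMinkowski_eq hF'
  rw [surfaceIntegrand_comp_coordMap hF hs] at hS hM
  rw [curvatureIntegrand_comp_coordMap hF hs] at hC hM
  filter_upwards [ae_gaussMinkowski_eq hF, hM,
    ae_integral_levelIntegrand_comp_coordMap hF hs (measurable_surfaceIntegrand hF)
      (ae_surfaceIntegrand_eq_zero F) hS,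
    ae_integral_levelIntegrand_comp_coordMap hF hs (measurable_curvatureIntegrand hF)
      (ae_curvatureIntegrand_eq_zero hF) hC] with u hu hu' h1 h2 hf1 hf2 l hl
  rw [cylinder_excursionSet]
  have h1' := h1 (hu.1.1.1 hf1)
  have h2' := h2 (hu.2.1.1 hf2)
  interval_cases l
  · exact ⟨trivial, gaussMinkowski_zero_cylinder hs
      (hF.continuous.measurable measurableSet_Ici)⟩
  · exact ⟨hu'.1.1.2 h1'.1, by rw [hu'.1.2, hu.1.2, h1'.2]⟩
  · exact ⟨hu'.2.1.2 h2'.1, by rw [hu'.2.2, hu.2.2, h2'.2]⟩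

end Cylinder

/-! ### From almost every level to neighbourhoods of one level. -/

section IndividualLevel

variable {k : ℕ} {F G : EuclideanSpace ℝ (Fin k) → ℝ} {u : ℝ}

lemma eventually_ae_restrict_ball {P : ℝ → Prop} {Q : ℝ → Prop} (hP : ∀ᶠ z in 𝓝 u, P z)
    (h : ∀ᵐ z, P z → Q z) :
    ∀ᶠ ε in 𝓝[>] (0 : ℝ), ∀ᵐ z ∂volume.restrict (Metric.ball u ε), Q z := by
  obtain ⟨r, hr, hball⟩ := Metric.eventually_nhds_iff_ball.1 hP
  filter_upwards [Ioo_mem_nhdsGT hr] with ε hε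
  rw [ae_restrict_iff' Metric.isOpen_ball.measurableSet]
  filter_upwards [h] with z hz hzε
  exact hz (hball z (Metric.ball_subset_ball hε.2.le hzε))

lemma levelLIntegral_neg_surfaceIntegrand (F : EuclideanSpace ℝ (Fin k) → ℝ) (z : ℝ) :
    levelLIntegral F (-surfaceIntegrand F) z = 0 := by
  have h0 (x : EuclideanSpace ℝ (Fin k)) :
      ENNReal.ofReal (levelIntegrand F (-surfaceIntegrand F) x) = 0 := by
    rw [levelIntegrand_neg]
    exact ENNReal.ofReal_of_nonpos (neg_nonpos.2 (mul_nonneg (gaussDensity_pos x).le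
      (div_nonneg (norm_nonneg _) (norm_nonneg _))))
  simp [levelLIntegral, h0]

/-- As `‖∇F‖ ≥ 0`, its expectation near the level is the integral of `ENNReal.ofReal (m z)`, which
is locally bounded by continuity. For the signed `G₂` cancellation could hide divergence, so there
integrability is a hypothesis. -/
lemma eventually_integrableOn_surfaceIntegrand (hF : ContDiff ℝ 2 F) {m : ℝ → ℝ}
    (hm : ContinuousAt m u)
    (hmF : ∀ᶠ ε in 𝓝[>] (0 : ℝ), ∀ᵐ z ∂volume.restrict (Metric.ball u ε),
      levelLIntegral F (surfaceIntegrand F) z = ENNReal.ofReal (m z)) :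
    ∀ᶠ ε in 𝓝[>] (0 : ℝ), IntegrableOn (surfaceIntegrand F) {x | |F x - u| < ε} (gauss k) := by
  obtain ⟨r, hr, hball⟩ := Metric.eventually_nhds_iff_ball.1
    (hm.eventually (gt_mem_nhds (lt_add_one (m u))))
  filter_upwards [hmF, Ioo_mem_nhdsGT hr] with ε hε hεr
  have hset : {x | |F x - u| < ε} = F ⁻¹' Metric.ball u ε := by
    ext x
    simp [Real.dist_eq]
  have hG := measurable_surfaceIntegrand hF
  have hball' : MeasurableSet (Metric.ball u ε) := Metric.isOpen_ball.measurableSet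
  rw [hset, IntegrableOn, integrable_iff_lintegral_parts hG,
    ← setLIntegral_levelLIntegral hF hG (ae_surfaceIntegrand_eq_zero F) hball',
    lintegral_congr_ae hε]
  constructor
  · refine ne_top_of_le_ne_top (b := ∫⁻ _ in Metric.ball u ε, ENNReal.ofReal (m u + 1)) ?_
      (setLIntegral_mono' hball' fun z hz => ENNReal.ofReal_le_ofReal
        (hball z (Metric.ball_subset_ball hεr.2.le hz)).le)
    rw [setLIntegral_const]
    exact ENNReal.mul_ne_top ENNReal.ofReal_ne_top measure_ball_lt_top.ne
  · have h0 (x : EuclideanSpace ℝ (Fin k)) : ENNReal.ofReal (-surfaceIntegrand F x) = 0 :=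
      ENNReal.ofReal_of_nonpos (neg_nonpos.2 (norm_nonneg _))
    simp [h0]

end IndividualLevel

end GaussTube

theorem corollary3p5 (k : ℕ) (F : EuclideanSpace ℝ (Fin k) → ℝ) (hF : ContDiff ℝ 2 F) :
    -- the formulas, for almost every level, and independence of the dimension
    (∀ᵐ u : ℝ,
      GaussTube.IsC2Domain (GaussTube.excursionSet F u) →
      GaussTube.GaussMinkowskiFinite (GaussTube.excursionSet F u) 1 →
      GaussTube.GaussMinkowskiFinite (GaussTube.excursionSet F u) 2 →
        (GaussTube.lawDensity F u ≠ 0 →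
          Integrable (GaussTube.surfaceIntegrand F) (GaussTube.condLaw F u) ∧
          Integrable (GaussTube.curvatureIntegrand F) (GaussTube.condLaw F u)) ∧
        GaussTube.gaussMinkowski (GaussTube.excursionSet F u) 1 =
          GaussTube.condMean (GaussTube.surfaceIntegrand F) F u * GaussTube.lawDensity F u ∧
        GaussTube.gaussMinkowski (GaussTube.excursionSet F u) 2 =
          GaussTube.condMean (GaussTube.curvatureIntegrand F) F u * GaussTube.lawDensity F u ∧
        ∀ (n : ℕ) (s : Fin k → Fin n), Function.Injective s → ∀ l ≤ 2,
          GaussTube.GaussMinkowskiFinite (GaussTube.cylinder s (GaussTube.excursionSet F u)) l ∧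
          GaussTube.gaussMinkowski (GaussTube.cylinder s (GaussTube.excursionSet F u)) l =
            GaussTube.gaussMinkowski (GaussTube.excursionSet F u) l) ∧
    -- the formulas at an individual level
    (∀ u : ℝ,
      (∀ᶠ z in 𝓝 u, GaussTube.IsC2Domain (GaussTube.excursionSet F z) ∧
        GaussTube.GaussMinkowskiFinite (GaussTube.excursionSet F z) 1 ∧
        GaussTube.GaussMinkowskiFinite (GaussTube.excursionSet F z) 2) →
      (ContinuousAt (fun z => GaussTube.gaussMinkowski (GaussTube.excursionSet F z) 1) u →
        GaussTube.HasCondDensityAt (GaussTube.surfaceIntegrand F) F u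
          (GaussTube.gaussMinkowski (GaussTube.excursionSet F u) 1)) ∧
      (ContinuousAt (fun z => GaussTube.gaussMinkowski (GaussTube.excursionSet F z) 2) u →
        (∃ δ > 0, IntegrableOn (GaussTube.curvatureIntegrand F) {x | |F x - u| < δ}
          (GaussTube.gauss k)) →
        GaussTube.HasCondDensityAt (GaussTube.curvatureIntegrand F) F u
          (GaussTube.gaussMinkowski (GaussTube.excursionSet F u) 2))) := by

  have hS0 := GaussTube.ae_surfaceIntegrand_eq_zero F
  have hC0 := GaussTube.ae_curvatureIntegrand_eq_zero hF
  have hSm := GaussTube.measurable_surfaceIntegrand hF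
  have hCm := GaussTube.measurable_curvatureIntegrand hF
  constructor
  · have hcyl : ∀ᵐ u : ℝ, ∀ (n : ℕ) (s : Fin k → Fin n), Function.Injective s →
        GaussTube.GaussMinkowskiFinite (GaussTube.excursionSet F u) 1 →
        GaussTube.GaussMinkowskiFinite (GaussTube.excursionSet F u) 2 → ∀ l ≤ 2,
          GaussTube.GaussMinkowskiFinite (GaussTube.cylinder s (GaussTube.excursionSet F u)) l ∧
          GaussTube.gaussMinkowski (GaussTube.cylinder s (GaussTube.excursionSet F u)) l =
            GaussTube.gaussMinkowski (GaussTube.excursionSet F u) l := by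
      -- There are only countably many pairs `(n, s)`, so one null set of levels serves all
      -- cylinders.
      refine ae_all_iff.2 fun n => ae_all_iff.2 fun s => ?_
      by_cases hs : Function.Injective s
      · filter_upwards [GaussTube.ae_gaussMinkowski_cylinder hF hs] with u hu _ using hu
      · exact Eventually.of_forall fun u h => absurd h hs
    filter_upwards [hcyl, GaussTube.ae_gaussMinkowski_eq hF,
      GaussTube.condMean_formula hF hSm hS0, GaussTube.condMean_formula hF hCm hC0]
      with u hu hM h1 h2 _ hf1 hf2
    have h1' := h1 (hM.1.1.1 hf1)
    have h2' := h2 (hM.2.1.1 hf2)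
    exact ⟨fun h0 => ⟨h1'.1 h0, h2'.1 h0⟩, hM.1.2.trans h1'.2, hM.2.2.trans h2'.2,
      fun n s hs l hl => hu n s hs hf1 hf2 l hl⟩
  · intro u hu
    refine ⟨fun hm => ?_, fun hm ⟨δ, hδ, hint⟩ => ?_⟩
    · have key := GaussTube.eventually_ae_restrict_ball
        -- Finiteness is carried along so that `toReal` can be undone when integrability is derived.
        (Q := fun z => GaussTube.levelLIntegral F (GaussTube.surfaceIntegrand F) z ≠ ∞ ∧
          GaussTube.gaussMinkowski (GaussTube.excursionSet F z) 1 =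
            (GaussTube.levelLIntegral F (GaussTube.surfaceIntegrand F) z).toReal -
              (GaussTube.levelLIntegral F (-GaussTube.surfaceIntegrand F) z).toReal) hu (by
        filter_upwards [GaussTube.ae_gaussMinkowski_eq hF] with z hz hz'
        have hint := hz.1.1.1 hz'.2.1
        exact ⟨((GaussTube.integrable_levelIntegrand_iff hF hSm z).1 hint).1,
          hz.1.2.trans (GaussTube.integral_levelIntegrand_eq hint)⟩)
      refine GaussTube.hasCondDensityAt_of_continuousAt hF hSm hS0 hm
        (key.mono fun ε h => h.mono fun z hz => hz.2)
        (GaussTube.eventually_integrableOn_surfaceIntegrand hF hm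
          (key.mono fun ε h => h.mono fun z hz => ?_))
      rw [hz.2, GaussTube.levelLIntegral_neg_surfaceIntegrand, ENNReal.toReal_zero, sub_zero,
        ENNReal.ofReal_toReal hz.1]
    · have key := GaussTube.eventually_ae_restrict_ball
        (Q := fun z => GaussTube.gaussMinkowski (GaussTube.excursionSet F z) 2 =
            (GaussTube.levelLIntegral F (GaussTube.curvatureIntegrand F) z).toReal -
              (GaussTube.levelLIntegral F (-GaussTube.curvatureIntegrand F) z).toReal) hu (by
        filter_upwards [GaussTube.ae_gaussMinkowski_eq hF] with z hz hz'
        exact hz.2.2.trans (GaussTube.integral_levelIntegrand_eq (hz.2.1.1 hz'.2.2)))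
      refine GaussTube.hasCondDensityAt_of_continuousAt hF hCm hC0 hm key ?_
      filter_upwards [Ioo_mem_nhdsGT hδ] with ε hε
      exact hint.mono_set fun x hx => lt_trans hx hε.2
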